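/- For integers $k\ge 3$, $r\ge 2$ let $\mathrm{SC}(k,r)$ be the set of $kr$ points in the plane consisting of the vertices of a (regular) convex $k$-gon together with $r-1$ (evenly spaced) points subdividing each of its sides, and let $\mathsf{tr}(k,r)$ be the number of triangulations of $\mathrm{SC}(k,r)$. Here a triangulation of a finite planar point set $S$ is a maximal set of pairwise non-crossing segments joining points of $S$, no segment having a further point of $S$ in its interior. For $k=2$ let $\mathsf{tr}(2,r)$ be the number of triangulations of a convex $2r$-gon with consecutive vertices $v_0,\dots,v_{2r-1}$ that use no diagonal joining two vertices of $\{v_0,\dots,v_r\}$ or two vertices of $\{v_r,\dots,v_{2r-1},v_0\}$. For $k=1$ put $$\mathsf{tr}(1,r)=-\tfrac12\,[t^{r-1}]\,\frac{(1-2t)\left((1-t)^{r+1}-t^{r+1}\right)}{(1-t)^{r}},$$ that is, $\mathsf{tr}(1,2)=\tfrac32$, $\mathsf{tr}(1,3)=-1$ and $\mathsf{tr}(1,r)=0$ for $r\ge4$. **Theorem.** Fix $r\ge2$ and let $$P_r(x;t)=t^{r}(1-t)^{r}-x\,\frac{(1-t)^{r+1}-t^{r+1}}{1-2t},$$ a polynomial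 in $t$ (the division is exact). Among the complex Puiseux series $t(x)$ in $x$ there are exactly $r$ distinct "small" zeroes $t_1(x),\dots,t_r(x)$ of $P_r(x;t)$, that is, zeroes with $\lim_{x\to0}t(x)=0$ (only positive exponents occur). They satisfy $\left(\frac{d}{dt}P_r\right)(x;t_i(x))\ne0$, and $$\sum_{k\ge1}\mathsf{tr}(k,r)\,x^k=-\frac12\sum_{i=1}^{r}\frac{t_i(x)^{r}\,(1-t_i(x))^{r}\,(1-2t_i(x))^{2}}{\left(\frac{d}{dt}P_r\right)(x;t_i(x))}$$ as an identity of Puiseux series in $x$. In particular, the generating function $\sum_{k\ge1}\mathsf{tr}(k,r)x^k$ is algebraic over $\mathbb{Q}(x)$. -/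

import Mathlib

open Polynomial

noncomputable section

/-! Planar point sets and their triangulations -/

/-- A straight-line graph on a planar point set `S` is plane if no edge passes through a point
of `S` other than its endpoints, and no two distinct edges share a point other than a common
endpoint. -/
def IsPlaneGraph (S : Set ℂ) (G : SimpleGraph S) : Prop :=
  (∀ p q : S, G.Adj p q → Disjoint (openSegment ℝ (p : ℂ) (q : ℂ)) S) ∧
  (∀ p q p' q' : S, G.Adj p q → G.Adj p' q' → s(p, q) ≠ s(p', q') →
    Disjoint (openSegment ℝ (p : ℂ) (q : ℂ)) (openSegment ℝ (p' : ℂ) (q' : ℂ)))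

/-- A triangulation of a planar point set, given by its edges: a maximal set of pairwise
non-crossing segments between points of `S`. -/
def IsTriangulation (S : Set ℂ) (G : SimpleGraph S) : Prop :=
  Maximal (IsPlaneGraph S) G

/-- The number of triangulations of `S`. -/
def numTriangulations (S : Set ℂ) : ℕ :=
  Nat.card {G : SimpleGraph S // IsTriangulation S G}

/-- The vertices of the regular `n`-gon, in clockwise order, cyclically indexed by `m`. -/
def gonPoint (n m : ℕ) : ℂ :=
  Complex.exp (-(2 * Real.pi * (m / n)) * Complex.I)

/-- The vertex set of the regular (hence convex) `n`-gon. -/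
def convexGon (n : ℕ) : Set ℂ :=
  {z | ∃ m < n, z = gonPoint n m}

/-- The point `P_{i,j}` of the subdivided `k`-gon: the `j`-th point on the `i`-th side, when
each side is divided into `r` equal parts. -/
def scPoint (k r i j : ℕ) : ℂ :=
  (1 - (j : ℂ) / r) * gonPoint k i + ((j : ℂ) / r) * gonPoint k (i + 1)

/-- The balanced subdivided convex polygon `SC(k,r)`: a convex `k`-gon each of whose sides is
subdivided by `r - 1` points (`k * r` points in total). -/
def SC (k r : ℕ) : Set ℂ :=
  {z | ∃ i < k, ∃ j < r, z = scPoint k r i j}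

/-- The vertices of the convex `k * r`-gon are grouped in `k` cyclically consecutive strings of
`r + 1` vertices, consecutive strings sharing one vertex. A diagonal is forbidden if it joins two
non-consecutive vertices of one string. -/
def IsForbidden (k r : ℕ) (a b : ℂ) : Prop :=
  ∃ i j j' : ℕ, i < k ∧ j + 2 ≤ j' ∧ j' ≤ r ∧
    a = gonPoint (k * r) (i * r + j) ∧ b = gonPoint (k * r) (i * r + j')

/-- The number of triangulations of the convex `k * r`-gon without forbidden diagonals. -/
def numLegal (k r : ℕ) : ℕ :=
  Nat.card {G : SimpleGraph (convexGon (k * r)) //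
    IsTriangulation (convexGon (k * r)) G ∧
      ∀ a b : convexGon (k * r), G.Adj a b → ¬ IsForbidden k r a b}

/-- The numbers `tr(k,r)` (for `r ≥ 2`). For `k ≥ 3` this is the number of triangulations of
`SC(k,r)`. For `k = 2`, where there is no polygon `SC(2,r)`, it is the number of
triangulations of the convex `2r`-gon without forbidden diagonals. For `k = 1` nothing is counted,
and `tr(1,r)` is the value `-(1/2) [t^(r-1)] (1-2t) ((1-t)^(r+1) - t^(r+1)) / (1-t)^r` of the
integral formula for `tr(k,r)`, that is, the coefficient of `t^(r-1)` in
`-(1/2) (1-2t) (1-t)`. -/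
def tr (k r : ℕ) : ℚ :=
  if 3 ≤ k then (numTriangulations (SC k r) : ℚ)
  else if k = 2 then (numLegal 2 r : ℚ)
  else if k = 1 then (if r = 2 then 3 / 2 else if r = 3 then -1 else 0)
  else 0

/-- The vertical generating function `∑_{k ≥ 1} tr(k,r) x^k` (note `tr 0 r = 0`). -/
def verticalGF (r : ℕ) : PowerSeries ℚ :=
  PowerSeries.mk fun k => tr k r

/-! Puiseux series and the polynomial `P_r` -/

/-- A Hahn series with rational exponents is a Puiseux series if its exponents have a common
denominator. (Its support is well-ordered, hence then bounded below.) -/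
def IsPuiseux (f : HahnSeries ℚ ℂ) : Prop :=
  ∃ n : ℕ, 0 < n ∧ ∀ q ∈ f.support, ∃ m : ℤ, q = m / n

/-- The polynomial `P_r(x;t) = t^r (1-t)^r - x ((1-t)^(r+1) - t^(r+1)) / (1-2t)` in the variable
`t`; the division is exact. -/
def vertPoly {K : Type*} [Field K] (x : K) (r : ℕ) : K[X] :=
  X ^ r * (1 - X) ^ r - C x * (((1 - X) ^ (r + 1) - X ^ (r + 1)) / (1 - 2 * X))

theorem vertPoly_div_exact {K : Type*} [Field K] (r : ℕ) :
    (1 - 2 * X) * ((((1 - X) ^ (r + 1) - X ^ (r + 1)) / (1 - 2 * X)) : K[X]) =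
      (1 - X) ^ (r + 1) - X ^ (r + 1) := by
  have h0 : (1 - 2 * X : K[X]) ≠ 0 := by
    intro h
    simpa using congrArg (Polynomial.eval 0) h
  have hd : (1 - 2 * X : K[X]) ∣ (1 - X) ^ (r + 1) - X ^ (r + 1) := by
    have h := sub_dvd_pow_sub_pow (1 - X : K[X]) X (r + 1)
    have e : (1 - X - X : K[X]) = 1 - 2 * X := by ring
    rwa [e] at h
  exact EuclideanDomain.mul_div_cancel' h0 hd

/-- The variable `x` as a Puiseux series. -/
def puiseuxX : HahnSeries ℚ ℂ := HahnSeries.single 1 1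

/-- The small zeroes of `P_r(x;t)`: the Puiseux series `t(x)` with `P_r(x;t(x)) = 0` and
`t(x) → 0` as `x → 0`, that is, all of whose exponents are positive. -/
def smallRoots (r : ℕ) : Set (HahnSeries ℚ ℂ) :=
  {t | IsPuiseux t ∧ (vertPoly puiseuxX r).eval t = 0 ∧ 0 < t.orderTop}

/-- A power series with rational coefficients, as a Puiseux series. -/
def toPuiseux (f : PowerSeries ℚ) : HahnSeries ℚ ℂ :=
  HahnSeries.ofPowerSeries ℚ ℂ (PowerSeries.map (algebraMap ℚ ℂ) f)

end

open Polynomial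

noncomputable section

/-! Label the `kr` points in cyclic order. Orientations of triples show that two chords containing
no further point cross exactly when their labels interleave, so a triangulation becomes a set of
index pairs in which every chord other than a side spans a triangle (`isTriangulation_iff`).
Splitting at the apex of the triangle on the base gives a Catalan recurrence in which forbidden
chords count zero.

The zeros are produced by signs. Let `N` be the matrix with `1` at `(i, i+1)` and `-1` at `(i, i+2)`
whenever `i+1` is interior to a side. Then `E = N C(N)`, with the Catalan series `C`, satisfies `E =
N + E²`: the entry `-1` cancels the only splitting of a forbidden chord of length two, and every
splitting of a longer one has a vanishing factor. So `E` counts triangulations, up to a correction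
where the last side closes up at label 0 (`tr_eq_earSum_sub`). The entries of `(1 - zN)⁻¹` factor
over the sides into the polynomials `u_r(z)`, whence `tr(k,r) = L(u_r^k)`, where `L` sends `z^n` to
the number of triangulations of an `n`-gon and `z` to `-1/2` (`tr_eq_gonFunctional`).

Summing over `k` gives `L(1 / (1 - x u_r(z)))`. In `s = t(1-t)`, the polynomial `P_r` becomes `p(s)
= s^r (1 - x u_r(1/s))`. If `s_i` are its roots, the coefficient of `z^m` in `1 / (1 - x u_r(z))` is
`∑ s_i^(m+r-1) / p'(s_i)` by Lagrange interpolation and a recurrence (`sum_pow_mul_nodalWeight_eq`).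
Since `t = s C(s)` for the small root, `∑ L(z^(n+1)) s^n = -(1-2t)/2`; with `dP_r/dt = p'(s)(1-2t)`
this is the formula. The roots come from Hensel's lemma after `x = Y^r`, `s = Y/v`, starting at `v =
ζ` with `ζ^r = 1` (`exists_puiseux_root`). Infinite sums are compared modulo every power of `x`. -/

/-! Triangulations of a convex polygon as sets of index pairs -/

/-- A set of pairwise non-crossing chords `(a, b)`, `i ≤ a < b ≤ j`, all of them allowed by `A`. -/
structure IsPlaneChords (A : ℕ → ℕ → Prop) (i j : ℕ) (T : Finset (ℕ × ℕ)) : Prop where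
  lower : ∀ a b, (a, b) ∈ T → i ≤ a
  lt : ∀ a b, (a, b) ∈ T → a < b
  upper : ∀ a b, (a, b) ∈ T → b ≤ j
  allowed : ∀ a b, (a, b) ∈ T → A a b
  noncrossing : ∀ a b c d, (a, b) ∈ T → (c, d) ∈ T → a < c → c < b → b < d → False

/-- The polygon with vertices `i, …, j` is cut into triangles by the chords of `T`: the base
`(i, j)` is in `T`, and every chord other than a side is the long side of a triangle. -/
structure IsChordTriang (A : ℕ → ℕ → Prop) (i j : ℕ) (T : Finset (ℕ × ℕ)) : Prop
    extends IsPlaneChords A i j T where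
  base : (i, j) ∈ T
  split : ∀ a b, (a, b) ∈ T → a + 1 < b → ∃ m, (a, m) ∈ T ∧ (m, b) ∈ T

namespace IsChordTriang

variable {A : ℕ → ℕ → Prop} {i j m : ℕ} {T T₁ T₂ : Finset (ℕ × ℕ)}

/-- A triangulation contains every chord that crosses none of its chords. -/
theorem mem_of_not_crossing (h : IsChordTriang A i j T) {c d : ℕ} (hc : i ≤ c) (hcd : c < d)
    (hd : d ≤ j) (h₁ : ∀ a b, (a, b) ∈ T → a < c → c < b → b < d → False)
    (h₂ : ∀ a b, (a, b) ∈ T → c < a → a < d → d < b → False) : (c, d) ∈ T := by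
  -- Descent through the triangles from the base: unless the current chord is `(c, d)` itself, an
  -- apex strictly between `c` and `d` would give a triangle side crossing `(c, d)`.
  suffices H : ∀ n a b, b - a ≤ n → (a, b) ∈ T → a ≤ c → d ≤ b → (c, d) ∈ T from
    H _ i j le_rfl h.base hc hd
  intro n
  induction n with
  | zero => intro a b hn hab ha hb; omega
  | succ n ih =>
    intro a b hn hab ha hb
    by_cases hs : a + 1 < b
    · obtain ⟨m, hm₁, hm₂⟩ := h.split a b hab hs
      have l₁ := h.lt _ _ hm₁
      have l₂ := h.lt _ _ hm₂
      rcases le_or_gt d m with hdm | hdm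
      · exact ih a m (by omega) hm₁ ha hdm
      rcases le_or_gt m c with hmc | hmc
      · exact ih m b (by omega) hm₂ hmc hb
      rcases eq_or_lt_of_le ha with rfl | ha
      · rcases eq_or_lt_of_le hb with rfl | hb
        · exact hab
        · exact (h₂ _ _ hm₂ hmc hdm hb).elim
      · exact (h₁ _ _ hm₁ ha hmc hdm).elim
    · obtain rfl : a = c := by omega
      obtain rfl : b = d := by omega
      exact hab

theorem restrict (h : IsChordTriang A i j T) {a b : ℕ} (hab : (a, b) ∈ T) :
    IsChordTriang A a b (T.filter fun e => a ≤ e.1 ∧ e.2 ≤ b) where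
  lower c d hcd := by simp at hcd; omega
  lt c d hcd := by simp at hcd; exact h.lt _ _ hcd.1
  upper c d hcd := by simp at hcd; omega
  allowed c d hcd := by simp at hcd; exact h.allowed _ _ hcd.1
  noncrossing c d e f hcd hef := by
    simp at hcd hef
    exact h.noncrossing _ _ _ _ hcd.1 hef.1
  base := by simpa using hab
  split c d hcd hs := by
    simp only [Finset.mem_filter] at hcd
    obtain ⟨m, h₁, h₂⟩ := h.split c d hcd.1 hs
    have l₁ := h.lt _ _ h₁
    have l₂ := h.lt _ _ h₂
    refine ⟨m, ?_, ?_⟩ <;> simp only [Finset.mem_filter] <;> refine ⟨by assumption, ?_⟩ <;> omega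

theorem join (h₁ : IsChordTriang A i m T₁) (h₂ : IsChordTriang A m j T₂) (hA : A i j) :
    IsChordTriang A i j (insert (i, j) (T₁ ∪ T₂)) := by
  have him := h₁.lt _ _ h₁.base
  have hmj := h₂.lt _ _ h₂.base
  have key : ∀ a b, (a, b) ∈ insert (i, j) (T₁ ∪ T₂) →
      (a = i ∧ b = j) ∨ ((a, b) ∈ T₁ ∧ i ≤ a ∧ a < b ∧ b ≤ m) ∨
        ((a, b) ∈ T₂ ∧ m ≤ a ∧ a < b ∧ b ≤ j) := by
    intro a b hab
    simp only [Finset.mem_insert, Prod.mk.injEq, Finset.mem_union] at hab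
    rcases hab with h | h | h
    · exact .inl h
    · exact .inr (.inl ⟨h, h₁.lower _ _ h, h₁.lt _ _ h, h₁.upper _ _ h⟩)
    · exact .inr (.inr ⟨h, h₂.lower _ _ h, h₂.lt _ _ h, h₂.upper _ _ h⟩)
  constructor
  · constructor
    · intro a b hab; rcases key a b hab with h | h | h <;> omega
    · intro a b hab; rcases key a b hab with h | h | h <;> omega
    · intro a b hab; rcases key a b hab with h | h | h <;> omega
    · intro a b hab
      rcases key a b hab with ⟨rfl, rfl⟩ | h | h
      · exact hA
      · exact h₁.allowed _ _ h.1
      · exact h₂.allowed _ _ h.1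
    · intro a b c d hab hcd l₁ l₂ l₃
      rcases key a b hab with h | h | h <;> rcases key c d hcd with h' | h' | h' <;> try omega
      · exact h₁.noncrossing _ _ _ _ h.1 h'.1 l₁ l₂ l₃
      · exact h₂.noncrossing _ _ _ _ h.1 h'.1 l₁ l₂ l₃
  · simp
  · intro a b hab hs
    rcases key a b hab with ⟨rfl, rfl⟩ | h | h
    · exact ⟨m, by simp [h₁.base], by simp [h₂.base]⟩
    · obtain ⟨m, h, h'⟩ := h₁.split a b h.1 hs
      exact ⟨m, by simp [h], by simp [h']⟩
    · obtain ⟨m, h, h'⟩ := h₂.split a b h.1 hs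
      exact ⟨m, by simp [h], by simp [h']⟩

/-- The apex of the triangle on the base separates a triangulation into two. -/
theorem eq_insert_union (h : IsChordTriang A i j T) (h₁ : (i, m) ∈ T) (h₂ : (m, j) ∈ T) :
    T = insert (i, j) ((T.filter fun e => i ≤ e.1 ∧ e.2 ≤ m) ∪
      T.filter fun e => m ≤ e.1 ∧ e.2 ≤ j) := by
  ext ⟨a, b⟩
  simp only [Finset.mem_insert, Prod.mk.injEq, Finset.mem_union, Finset.mem_filter]
  constructor
  · intro hab
    have l := h.lower _ _ hab
    have l' := h.upper _ _ hab
    have l'' := h.lt _ _ hab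
    by_cases hbm : b ≤ m
    · exact .inr (.inl ⟨hab, l, hbm⟩)
    by_cases hma : m ≤ a
    · exact .inr (.inr ⟨hab, hma, l'⟩)
    left
    by_contra hne
    rcases eq_or_lt_of_le l with rfl | l
    · exact h.noncrossing _ _ _ _ hab h₂ (by omega) (by omega) (by omega)
    · exact h.noncrossing _ _ _ _ h₁ hab (by omega) (by omega) (by omega)
  · rintro (⟨rfl, rfl⟩ | h | h)
    · exact h.base
    · exact h.1
    · exact h.1

theorem filter_left (h₁ : IsChordTriang A i m T₁) (h₂ : IsChordTriang A m j T₂) :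
    (insert (i, j) (T₁ ∪ T₂)).filter (fun e => i ≤ e.1 ∧ e.2 ≤ m) = T₁ := by
  have him := h₁.lt _ _ h₁.base
  have hmj := h₂.lt _ _ h₂.base
  ext ⟨a, b⟩
  simp only [Finset.mem_insert, Prod.mk.injEq, Finset.mem_union, Finset.mem_filter]
  constructor
  · rintro ⟨h | h | h, h', h''⟩
    · omega
    · exact h
    · have := h₂.lower _ _ h
      have := h₂.lt _ _ h
      omega
  · intro h
    exact ⟨.inr (.inl h), h₁.lower _ _ h, h₁.upper _ _ h⟩

theorem filter_right (h₁ : IsChordTriang A i m T₁) (h₂ : IsChordTriang A m j T₂) :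
    (insert (i, j) (T₁ ∪ T₂)).filter (fun e => m ≤ e.1 ∧ e.2 ≤ j) = T₂ := by
  have him := h₁.lt _ _ h₁.base
  have hmj := h₂.lt _ _ h₂.base
  ext ⟨a, b⟩
  simp only [Finset.mem_insert, Prod.mk.injEq, Finset.mem_union, Finset.mem_filter]
  constructor
  · rintro ⟨h | h | h, h', h''⟩
    · omega
    · have := h₁.upper _ _ h
      have := h₁.lt _ _ h
      omega
    · exact h
  · intro h
    exact ⟨.inr (.inr h), h₂.lower _ _ h, h₂.upper _ _ h⟩

end IsChordTriang

open Classical in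
/-- The triangulations of the polygon `i, …, j` by allowed chords. -/
def chordTriangs (A : ℕ → ℕ → Prop) (i j : ℕ) : Finset (Finset (ℕ × ℕ)) :=
  (Finset.Icc i j ×ˢ Finset.Icc i j).powerset.filter (IsChordTriang A i j)

theorem mem_chordTriangs {A : ℕ → ℕ → Prop} {i j : ℕ} {T : Finset (ℕ × ℕ)} :
    T ∈ chordTriangs A i j ↔ IsChordTriang A i j T := by
  simp only [chordTriangs, Finset.mem_filter, Finset.mem_powerset, and_iff_right_iff_imp]
  rintro h ⟨a, b⟩ hab
  have h₁ := h.lower _ _ hab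
  have h₂ := h.lt _ _ hab
  have h₃ := h.upper _ _ hab
  simp only [Finset.mem_product, Finset.mem_Icc]
  omega

theorem card_chordTriangs_succ {A : ℕ → ℕ → Prop} {i : ℕ} (hA : A i (i + 1)) :
    (chordTriangs A i (i + 1)).card = 1 := by
  rw [Finset.card_eq_one]
  refine ⟨{(i, i + 1)}, ?_⟩
  ext T
  rw [mem_chordTriangs, Finset.mem_singleton]
  constructor
  · intro h
    ext ⟨a, b⟩
    simp only [Finset.mem_singleton, Prod.mk.injEq]
    constructor
    · intro hab
      have h₁ := h.lower _ _ hab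
      have h₂ := h.lt _ _ hab
      have h₃ := h.upper _ _ hab
      omega
    · rintro ⟨rfl, rfl⟩
      exact h.base
  · rintro rfl
    refine ⟨⟨?_, ?_, ?_, ?_, ?_⟩, ?_, ?_⟩ <;> simp only [Finset.mem_singleton, Prod.mk.injEq]
    · omega
    · omega
    · omega
    · rintro a b ⟨rfl, rfl⟩
      exact hA
    · omega
    · omega

theorem card_chordTriangs_of_not {A : ℕ → ℕ → Prop} {i j : ℕ} (hA : ¬ A i j) :
    (chordTriangs A i j).card = 0 := by
  rw [Finset.card_eq_zero, Finset.eq_empty_iff_forall_notMem]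
  intro T hT
  rw [mem_chordTriangs] at hT
  exact hA (hT.allowed _ _ hT.base)

/-- The apex of the triangle on the base is unique, since two candidates would give crossing chords,
and it cuts the triangulation into two independent ones. -/
theorem card_chordTriangs {A : ℕ → ℕ → Prop} {i j : ℕ} (hij : i + 1 < j) (hA : A i j) :
    (chordTriangs A i j).card =
      ∑ m ∈ Finset.Ioo i j, (chordTriangs A i m).card * (chordTriangs A m j).card := by
  simp_rw [← Finset.card_product]
  rw [← Finset.card_sigma]
  symm
  refine Finset.card_bij (fun x _ => insert (i, j) (x.2.1 ∪ x.2.2)) ?_ ?_ ?_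
  · rintro ⟨m, T₁, T₂⟩ h
    simp only [Finset.mem_sigma, Finset.mem_product, mem_chordTriangs] at h ⊢
    exact h.2.1.join h.2.2 hA
  · rintro ⟨m, T₁, T₂⟩ h ⟨m', T₁', T₂'⟩ h' heq
    simp only [Finset.mem_sigma, Finset.mem_product, mem_chordTriangs, Finset.mem_Ioo] at h h' heq
    have hJ := h.2.1.join h.2.2 hA
    have e₁ : (i, m) ∈ insert (i, j) (T₁ ∪ T₂) := by simp [h.2.1.base]
    have e₂ : (m, j) ∈ insert (i, j) (T₁ ∪ T₂) := by simp [h.2.2.base]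
    have e₁' : (i, m') ∈ insert (i, j) (T₁ ∪ T₂) := by rw [heq]; simp [h'.2.1.base]
    have e₂' : (m', j) ∈ insert (i, j) (T₁ ∪ T₂) := by rw [heq]; simp [h'.2.2.base]
    obtain rfl : m = m' := by
      rcases lt_trichotomy m m' with hlt | rfl | hlt
      · exact (hJ.noncrossing _ _ _ _ e₁' e₂ (by omega) (by omega) (by omega)).elim
      · rfl
      · exact (hJ.noncrossing _ _ _ _ e₁ e₂' (by omega) (by omega) (by omega)).elim
    have := h.2.1.filter_left h.2.2
    rw [heq, h'.2.1.filter_left h'.2.2] at this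
    have := h.2.1.filter_right h.2.2
    rw [heq, h'.2.1.filter_right h'.2.2] at this
    simp_all
  · intro T hT
    rw [mem_chordTriangs] at hT
    obtain ⟨m, h₁, h₂⟩ := hT.split i j hT.base hij
    have l₁ := hT.lt _ _ h₁
    have l₂ := hT.lt _ _ h₂
    refine ⟨⟨m, T.filter fun e => i ≤ e.1 ∧ e.2 ≤ m, T.filter fun e => m ≤ e.1 ∧ e.2 ≤ j⟩, ?_,
      (hT.eq_insert_union h₁ h₂).symm⟩
    simp only [Finset.mem_sigma, Finset.mem_product, mem_chordTriangs, Finset.mem_Ioo]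
    exact ⟨⟨l₁, l₂⟩, hT.restrict h₁, hT.restrict h₂⟩

/-! ### Maximal plane chord sets are triangulations -/

/-- The condition on the allowed chords under which maximal sets of non-crossing allowed chords
are triangulations. -/
structure IsAdmissible (A : ℕ → ℕ → Prop) (i j : ℕ) : Prop where
  side : ∀ a, A a (a + 1)
  base : A i j
  push : ∀ a m b, i ≤ a → a < m → m < b → b ≤ j → A a b → A a m → ¬ A m b →
    A a (m + 1) ∧ ∀ d, m + 1 < d → d ≤ b → ¬ A m d

theorem IsPlaneChords.insert {A : ℕ → ℕ → Prop} {i j c d : ℕ} {T : Finset (ℕ × ℕ)}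
    (h : IsPlaneChords A i j T) (hc : i ≤ c) (hcd : c < d) (hd : d ≤ j) (hA : A c d)
    (h₁ : ∀ a b, (a, b) ∈ T → a < c → c < b → b < d → False)
    (h₂ : ∀ a b, (a, b) ∈ T → c < a → a < d → d < b → False) :
    IsPlaneChords A i j (insert (c, d) T) := by
  constructor
  · intro a b hab
    simp only [Finset.mem_insert, Prod.mk.injEq] at hab
    rcases hab with ⟨rfl, rfl⟩ | hab
    exacts [hc, h.lower _ _ hab]
  · intro a b hab
    simp only [Finset.mem_insert, Prod.mk.injEq] at hab
    rcases hab with ⟨rfl, rfl⟩ | hab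
    exacts [hcd, h.lt _ _ hab]
  · intro a b hab
    simp only [Finset.mem_insert, Prod.mk.injEq] at hab
    rcases hab with ⟨rfl, rfl⟩ | hab
    exacts [hd, h.upper _ _ hab]
  · intro a b hab
    simp only [Finset.mem_insert, Prod.mk.injEq] at hab
    rcases hab with ⟨rfl, rfl⟩ | hab
    exacts [hA, h.allowed _ _ hab]
  · intro a b a' b' hab hab' l₁ l₂ l₃
    simp only [Finset.mem_insert, Prod.mk.injEq] at hab hab'
    rcases hab with ⟨rfl, rfl⟩ | hab <;> rcases hab' with ⟨rfl, rfl⟩ | hab'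
    · omega
    · exact h₂ _ _ hab' l₁ l₂ l₃
    · exact h₁ _ _ hab l₁ l₂ l₃
    · exact h.noncrossing _ _ _ _ hab hab' l₁ l₂ l₃

/-- For a chord `(a, b)` of a maximal set let `m` be the last neighbour of `a` before `b`. If `(m,
b)` is allowed, it crosses nothing, so it is present. Otherwise `push` makes `(a, m + 1)` an allowed
chord that crosses nothing, against the choice of `m`. The converse is `mem_of_not_crossing`. -/
theorem IsAdmissible.maximal_iff {A : ℕ → ℕ → Prop} {i j : ℕ} (hA : IsAdmissible A i j)
    (hij : i < j) {T : Finset (ℕ × ℕ)} :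
    Maximal (IsPlaneChords A i j) T ↔ IsChordTriang A i j T := by
  constructor
  · intro hT
    have h := hT.prop
    have add : ∀ c d, i ≤ c → c < d → d ≤ j → A c d →
        (∀ a b, (a, b) ∈ T → a < c → c < b → b < d → False) →
        (∀ a b, (a, b) ∈ T → c < a → a < d → d < b → False) → (c, d) ∈ T := by
      intro c d hc hcd hd hA h₁ h₂
      exact hT.le_of_ge (h.insert hc hcd hd hA h₁ h₂) (Finset.subset_insert _ _)
        (Finset.mem_insert_self _ _)
    refine ⟨h, ?_, ?_⟩
    · refine add i j le_rfl hij le_rfl hA.base ?_ ?_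
      · intro a b hab l; have := h.lower _ _ hab; omega
      · intro a b hab _ _ l; have := h.upper _ _ hab; omega
    · intro a b hab hs
      have hia := h.lower _ _ hab
      have hbj := h.upper _ _ hab
      have side : (a, a + 1) ∈ T :=
        add a (a + 1) hia (by omega) (by omega) (hA.side a) (by intros; omega) (by intros; omega)
      obtain ⟨m, ⟨ham, hmb, hmT⟩, hmax⟩ : ∃ m, (a < m ∧ m < b ∧ (a, m) ∈ T) ∧
          ∀ m', (a < m' ∧ m' < b ∧ (a, m') ∈ T) → m' ≤ m := by
        classical
        have hne : ((Finset.Ioo a b).filter fun m => (a, m) ∈ T).Nonempty :=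
          ⟨a + 1, by simp [side, hs]⟩
        have hmem := Finset.max'_mem _ hne
        rw [Finset.mem_filter, Finset.mem_Ioo, and_assoc] at hmem
        refine ⟨_, hmem, fun m' hm' => Finset.le_max' _ _ ?_⟩
        rwa [Finset.mem_filter, Finset.mem_Ioo, and_assoc]
      refine ⟨m, hmT, ?_⟩
      by_cases hAm : A m b
      · refine add m b (by omega) hmb hbj hAm ?_ ?_
        · intro c d hcd l₁ l₂ l₃
          rcases lt_trichotomy c a with l | rfl | l
          · exact h.noncrossing _ _ _ _ hcd hab l (by omega) (by omega)
          · have := hmax d ⟨by omega, by omega, hcd⟩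
            omega
          · exact h.noncrossing _ _ _ _ hmT hcd l (by omega) (by omega)
        · intro c d hcd l₁ l₂ l₃
          exact h.noncrossing _ _ _ _ hab hcd (by omega) (by omega) (by omega)
      · exfalso
        obtain ⟨hA₁, hA₂⟩ := hA.push a m b hia ham hmb hbj (h.allowed _ _ hab)
          (h.allowed _ _ hmT) hAm
        have hmb' : m + 1 < b := by
          by_contra hc
          obtain rfl : b = m + 1 := by omega
          exact hAm (hA.side m)
        have : (a, m + 1) ∈ T := by
          refine add a (m + 1) hia (by omega) (by omega) hA₁ ?_ ?_
          · intro c d hcd l₁ l₂ l₃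
            exact h.noncrossing _ _ _ _ hcd hab l₁ (by omega) (by omega)
          · intro c d hcd l₁ l₂ l₃
            have hdb : d ≤ b := by
              by_contra l
              exact h.noncrossing _ _ _ _ hab hcd (by omega) (by omega) (by omega)
            rcases lt_or_ge c m with l | l
            · exact h.noncrossing _ _ _ _ hmT hcd (by omega) (by omega) (by omega)
            · obtain rfl : c = m := by omega
              exact hA₂ d l₃ hdb (h.allowed _ _ hcd)
        have := hmax (m + 1) ⟨by omega, hmb', this⟩
        omega
  · intro h
    refine ⟨h.toIsPlaneChords, fun T' hT' hle => ?_⟩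
    rintro ⟨c, d⟩ hcd
    refine h.mem_of_not_crossing (hT'.lower _ _ hcd) (hT'.lt _ _ hcd) (hT'.upper _ _ hcd) ?_ ?_
    · intro a b hab
      exact hT'.noncrossing _ _ _ _ (hle hab) hcd
    · intro a b hab
      exact hT'.noncrossing _ _ _ _ hcd (hle hab)

/-- Allowedness only restricts the members of a triangulation; isolating it serves the comparison
with all triangulations of the convex polygon. -/
theorem isChordTriang_iff_true {A : ℕ → ℕ → Prop} {i j : ℕ} {T : Finset (ℕ × ℕ)} :
    IsChordTriang A i j T ↔
      IsChordTriang (fun _ _ => True) i j T ∧ ∀ a b, (a, b) ∈ T → A a b :=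
  ⟨fun h => ⟨⟨⟨h.lower, h.lt, h.upper, fun _ _ _ => trivial, h.noncrossing⟩, h.base, h.split⟩,
    h.allowed⟩, fun h => ⟨⟨h.1.lower, h.1.lt, h.1.upper, h.2, h.1.noncrossing⟩, h.1.base, h.1.split⟩⟩

/-! Orientation of point triples on a subdivided regular polygon -/

/-- Twice the signed area of the triangle `p q s`, positive if it is traversed clockwise. -/
def turn (p q s : ℂ) : ℝ :=
  (q.im - p.im) * (s.re - p.re) - (q.re - p.re) * (s.im - p.im)

theorem turn_rotate (p q s : ℂ) : turn p q s = turn q s p := by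
  unfold turn; ring

theorem turn_swap (p q s : ℂ) : turn q p s = -turn p q s := by
  unfold turn; ring

theorem turn_flip (p q s : ℂ) : turn p q s = -turn p s q := by
  unfold turn; ring

theorem turn_self (p s : ℂ) : turn p p s = 0 := by
  unfold turn; ring

theorem turn_self_left (p q : ℂ) : turn p q p = 0 := by
  unfold turn; ring

theorem turn_self_right (p q : ℂ) : turn p q q = 0 := by
  unfold turn; ring

theorem turn_combination (u v p q : ℂ) {a b : ℝ} (hab : a + b = 1) :
    turn u v (a • p + b • q) = a * turn u v p + b * turn u v q := by
  obtain rfl : b = 1 - a := by linarith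
  simp only [turn, Complex.add_re, Complex.add_im, Complex.real_smul, Complex.re_ofReal_mul,
    Complex.im_ofReal_mul]
  ring

theorem disjoint_openSegment_of_turn_pos {p q c d : ℂ} (hc : 0 ≤ turn p q c) (hd : 0 ≤ turn p q d)
    (h : 0 < turn p q c ∨ 0 < turn p q d) :
    Disjoint (openSegment ℝ p q) (openSegment ℝ c d) := by
  rw [Set.disjoint_left]
  rintro z ⟨a, b, ha, hb, hab, rfl⟩ ⟨a', b', ha', hb', hab', heq⟩
  have h₁ := turn_combination p q p q hab
  rw [← heq, turn_combination p q c d hab', turn_self_left, turn_self_right] at h₁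
  rcases h with h | h
  · have := mul_pos ha' h
    have := mul_nonneg hb'.le hd
    linarith
  · have := mul_pos hb' h
    have := mul_nonneg ha'.le hc
    linarith

theorem disjoint_openSegment_of_turn_neg {p q c d : ℂ} (hc : turn p q c ≤ 0) (hd : turn p q d ≤ 0)
    (h : turn p q c < 0 ∨ turn p q d < 0) :
    Disjoint (openSegment ℝ p q) (openSegment ℝ c d) := by
  rw [openSegment_symm]
  apply disjoint_openSegment_of_turn_pos <;> simpa only [turn_swap p q, neg_pos, neg_nonneg]

/-- Covers collinear segments, where all turns of the endpoints vanish: a linear function increasing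
along the line separates them. -/
theorem disjoint_openSegment_of_separated {u v p q c d : ℂ} (h₁ : turn u v p < turn u v q)
    (h₂ : turn u v q ≤ turn u v c) (h₃ : turn u v c < turn u v d) :
    Disjoint (openSegment ℝ p q) (openSegment ℝ c d) := by
  rw [Set.disjoint_left]
  rintro z ⟨a, b, ha, hb, hab, rfl⟩ ⟨a', b', ha', hb', hab', heq⟩
  have h := turn_combination u v p q hab
  rw [← heq, turn_combination u v c d hab'] at h
  obtain rfl : b = 1 - a := by linarith
  obtain rfl : a' = 1 - b' := by linarith
  nlinarith [mul_pos ha (sub_pos.2 h₁), mul_pos hb' (sub_pos.2 h₃)]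

theorem notMem_openSegment_of_turn_ne_zero {p q z : ℂ} (h : turn p q z ≠ 0) :
    z ∉ openSegment ℝ p q := by
  rintro ⟨a, b, ha, hb, hab, rfl⟩
  rw [turn_combination p q p q hab, turn_self_left, turn_self_right] at h
  simp at h

theorem notMem_openSegment_of_lt {u v p q z : ℂ} (h₁ : turn u v z < turn u v p)
    (h₂ : turn u v p < turn u v q) : z ∉ openSegment ℝ p q := by
  rintro ⟨a, b, ha, hb, hab, rfl⟩
  rw [turn_combination u v p q hab] at h₁
  obtain rfl : a = 1 - b := by linarith
  nlinarith [mul_pos hb (sub_pos.2 h₂)]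

theorem notMem_openSegment_of_gt {u v p q z : ℂ} (h₁ : turn u v p < turn u v q)
    (h₂ : turn u v q < turn u v z) : z ∉ openSegment ℝ p q := by
  rintro ⟨a, b, ha, hb, hab, rfl⟩
  rw [turn_combination u v p q hab] at h₂
  obtain rfl : b = 1 - a := by linarith
  nlinarith [mul_pos ha (sub_pos.2 h₁)]

/-- The diagonals of a strictly convex quadrilateral `p c q d` cross. -/
theorem not_disjoint_openSegment {p c q d : ℂ} (h₁ : 0 < turn p c q) (h₂ : 0 < turn p q d)
    (h₃ : 0 < turn p c d) (h₄ : 0 < turn c q d) :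
    ¬ Disjoint (openSegment ℝ p q) (openSegment ℝ c d) := by
  have e : turn p c q + turn p q d = turn p c d + turn c q d := by unfold turn; ring
  have hs : 0 < turn p c q + turn p q d := by positivity
  have hs' : 0 < turn p c d + turn c q d := by positivity
  rw [Set.not_disjoint_iff]
  -- The crossing point divides each diagonal in the ratio of the distances of its ends from the
  -- other diagonal; the turns are proportional to these distances.
  refine ⟨(turn c q d / (turn p c d + turn c q d)) • p +
    (turn p c d / (turn p c d + turn c q d)) • q,
    ⟨_, _, div_pos h₄ hs', div_pos h₃ hs', by field_simp; ring, rfl⟩,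
    ⟨turn p q d / (turn p c q + turn p q d), turn p c q / (turn p c q + turn p q d),
    div_pos h₂ hs, div_pos h₁ hs, by field_simp; ring, ?_⟩⟩
  rw [← e]
  have hs0 := hs.ne'
  apply Complex.ext <;>
    simp only [Complex.add_re, Complex.add_im, Complex.real_smul, Complex.re_ofReal_mul,
      Complex.im_ofReal_mul] <;>
    rw [← sub_eq_zero] <;> field_simp <;> unfold turn <;> ring

theorem gonPoint_re (n m : ℕ) : (gonPoint n m).re = Real.cos (2 * (Real.pi * (m / n))) := by
  rw [gonPoint, show -(2 * (Real.pi : ℂ) * (m / n)) * Complex.I =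
    ((-(2 * (Real.pi * (m / n))) : ℝ) : ℂ) * Complex.I by push_cast; ring,
    Complex.exp_ofReal_mul_I_re, Real.cos_neg]

theorem gonPoint_im (n m : ℕ) : (gonPoint n m).im = -Real.sin (2 * (Real.pi * (m / n))) := by
  rw [gonPoint, show -(2 * (Real.pi : ℂ) * (m / n)) * Complex.I =
    ((-(2 * (Real.pi * (m / n))) : ℝ) : ℂ) * Complex.I by push_cast; ring,
    Complex.exp_ofReal_mul_I_im, Real.sin_neg]

theorem gonPoint_self {n : ℕ} (hn : n ≠ 0) : gonPoint n n = gonPoint n 0 := by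
  have : (n : ℝ) / n = 1 := div_self (by exact_mod_cast hn)
  apply Complex.ext
  · simp [gonPoint_re, this]
  · simp [gonPoint_im, this]

/-- By the sum-to-product formulas the area factors into sines of half the central angles, so its
sign can be read off the cyclic order. -/
theorem turn_gonPoint (n a b c : ℕ) : turn (gonPoint n a) (gonPoint n b) (gonPoint n c) =
    4 * Real.sin (Real.pi * ((b - a : ℝ) / n)) * Real.sin (Real.pi * ((c - b : ℝ) / n)) *
      Real.sin (Real.pi * ((c - a : ℝ) / n)) := by
  have hcos (x y : ℝ) : Real.cos (2 * x) - Real.cos (2 * y) =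
      -2 * Real.sin (x + y) * Real.sin (x - y) := by
    rw [Real.cos_sub_cos]; congr 3 <;> ring
  have hsin (x y : ℝ) : Real.sin (2 * x) - Real.sin (2 * y) =
      2 * Real.sin (x - y) * Real.cos (x + y) := by
    rw [Real.sin_sub_sin]; congr 3 <;> ring
  rw [show Real.pi * ((b - a : ℝ) / n) = Real.pi * (b / n : ℝ) - Real.pi * (a / n : ℝ) by ring,
    show Real.pi * ((c - b : ℝ) / n) = Real.pi * (c / n : ℝ) - Real.pi * (b / n : ℝ) by ring,
    show Real.pi * ((c - a : ℝ) / n) = Real.pi * (c / n : ℝ) - Real.pi * (a / n : ℝ) by ring]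
  simp only [turn, gonPoint_re, gonPoint_im, neg_sub_neg]
  set x := Real.pi * (a / n : ℝ)
  set y := Real.pi * (b / n : ℝ)
  set z := Real.pi * (c / n : ℝ)
  have e : Real.sin (z - y) = Real.sin (z + x) * Real.cos (x + y) -
      Real.cos (z + x) * Real.sin (x + y) := by
    rw [← Real.sin_sub]; congr 1; ring
  rw [hcos, hcos, hsin, hsin, e, ← neg_sub y x, Real.sin_neg, ← neg_sub z x, Real.sin_neg,
    add_comm y x, add_comm x z]
  ring

theorem sin_nonneg_of_le {n : ℕ} {a b : ℕ} (hab : a ≤ b) (hb : b ≤ n) :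
    0 ≤ Real.sin (Real.pi * ((b - a : ℝ) / n)) := by
  have h₁ : (a : ℝ) ≤ b := by exact_mod_cast hab
  have h₂ : (b - a : ℝ) ≤ n := by
    have : (b : ℝ) ≤ n := by exact_mod_cast hb
    have : (0 : ℝ) ≤ a := by positivity
    linarith
  have h₃ : 0 ≤ (b - a : ℝ) / n := div_nonneg (by linarith) (by positivity)
  apply Real.sin_nonneg_of_nonneg_of_le_pi
  · have := Real.pi_pos
    positivity
  · have : (b - a : ℝ) / n ≤ 1 := div_le_one_of_le₀ h₂ (by positivity)
    nlinarith [Real.pi_pos]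

theorem sin_pos_of_lt {n : ℕ} {a b : ℕ} (hab : a < b) (hb : b < n + a) :
    0 < Real.sin (Real.pi * ((b - a : ℝ) / n)) := by
  have h₁ : (a : ℝ) < b := by exact_mod_cast hab
  have h₂ : (b - a : ℝ) < n := by
    have : (b : ℝ) < n + a := by exact_mod_cast hb
    linarith
  have h₀ : (0 : ℝ) < n := by linarith
  have h₃ : 0 < (b - a : ℝ) / n := div_pos (by linarith) h₀
  apply Real.sin_pos_of_pos_of_lt_pi
  · have := Real.pi_pos
    positivity
  · have : (b - a : ℝ) / n < 1 := (div_lt_one h₀).2 h₂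
    nlinarith [Real.pi_pos]

theorem turn_gonPoint_nonneg {n a b c : ℕ} (hab : a ≤ b) (hbc : b ≤ c) (hc : c ≤ n) :
    0 ≤ turn (gonPoint n a) (gonPoint n b) (gonPoint n c) := by
  rw [turn_gonPoint]
  have h₁ := sin_nonneg_of_le hab (hbc.trans hc)
  have h₂ := sin_nonneg_of_le hbc hc
  have h₃ := sin_nonneg_of_le (hab.trans hbc) hc
  positivity

theorem turn_gonPoint_pos {n a b c : ℕ} (hab : a < b) (hbc : b < c) (hc : c < n + a) :
    0 < turn (gonPoint n a) (gonPoint n b) (gonPoint n c) := by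
  rw [turn_gonPoint]
  have h₁ := sin_pos_of_lt (n := n) hab (by omega)
  have h₂ := sin_pos_of_lt (n := n) hbc (by omega)
  have h₃ := sin_pos_of_lt (n := n) (hab.trans hbc) hc
  positivity

/-- The points of `SC(k,r)` in cyclic order. -/
def scLabel (k r m : ℕ) : ℂ := scPoint k r (m / r) (m % r)

theorem scPoint_eq_combination (k r i j : ℕ) : scPoint k r i j =
    (1 - (j / r : ℝ)) • gonPoint k i + (j / r : ℝ) • gonPoint k (i + 1) := by
  simp [scPoint, Complex.real_smul]

theorem scLabel_add {k r i j : ℕ} (hr : 0 < r) (hj : j ≤ r) :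
    scLabel k r (i * r + j) = scPoint k r i j := by
  rcases eq_or_lt_of_le hj with rfl | hj
  · have : (j : ℂ) ≠ 0 := by exact_mod_cast hr.ne'
    rw [scLabel, show i * j + j = (i + 1) * j by ring, Nat.mul_div_cancel _ hr, Nat.mul_mod_left]
    simp [scPoint, div_self this]
  · rw [scLabel, show i * r + j = j + r * i by ring, Nat.add_mul_div_left _ _ hr,
      Nat.add_mul_mod_self_left, Nat.mod_eq_of_lt hj, Nat.div_eq_of_lt hj, zero_add]

theorem scLabel_self {k r : ℕ} (hk : 0 < k) (hr : 0 < r) :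
    scLabel k r (k * r) = scLabel k r 0 := by
  have h₁ := scLabel_add (k := k) (i := k) hr (Nat.zero_le r)
  have h₂ := scLabel_add (k := k) (i := 0) hr (Nat.zero_le r)
  simp only [add_zero, zero_mul] at h₁ h₂
  rw [h₁, h₂]
  simp [scPoint, gonPoint_self hk.ne']

theorem mem_SC_iff {k r : ℕ} {z : ℂ} : z ∈ SC k r ↔ ∃ m < k * r, z = scLabel k r m := by
  constructor
  · rintro ⟨i, hi, j, hj, rfl⟩
    refine ⟨i * r + j, ?_, (scLabel_add (by omega) hj.le).symm⟩
    calc i * r + j < (i + 1) * r := by rw [add_one_mul]; omega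
      _ ≤ k * r := Nat.mul_le_mul_right _ hi
  · rintro ⟨m, hm, rfl⟩
    have hr : 0 < r := Nat.pos_of_ne_zero (by rintro rfl; simp at hm)
    exact ⟨m / r, Nat.div_lt_of_lt_mul (by rwa [mul_comm]), m % r, Nat.mod_lt _ hr, rfl⟩

theorem SC_one (n : ℕ) : SC n 1 = convexGon n := by
  ext z
  simp [SC, convexGon, scPoint]

/-- `a ≤ c` are positions on one side of the subdivided polygon. -/
def SameSide (r a c : ℕ) : Prop := ∃ i, i * r ≤ a ∧ c ≤ (i + 1) * r

/-- The points with labels `a < b < c` are on a line. -/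
def IsFlat (k r a b c : ℕ) : Prop := SameSide r a c ∨ a = 0 ∧ (k - 1) * r ≤ b

/-- The chords of the cyclically ordered points of `SC(k,r)` that pass through a further point. -/
def BadChord (k r a b : ℕ) : Prop :=
  a + 2 ≤ b ∧ (SameSide r a b ∨ a = 0 ∧ (k - 1) * r ≤ b ∧ b + 2 ≤ k * r)

theorem turn_scPoint (k r i j : ℕ) (u v : ℂ) : turn u v (scPoint k r i j) =
    (1 - (j / r : ℝ)) * turn u v (gonPoint k i) + (j / r : ℝ) * turn u v (gonPoint k (i + 1)) := by
  rw [scPoint_eq_combination, turn_combination _ _ _ _ (by ring)]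

theorem turn_scPoint_mid (k r i j : ℕ) (u v : ℂ) : turn u (scPoint k r i j) v =
    (1 - (j / r : ℝ)) * turn u (gonPoint k i) v + (j / r : ℝ) * turn u (gonPoint k (i + 1)) v := by
  rw [← turn_rotate v u, ← turn_rotate v u, ← turn_rotate v u, turn_scPoint]

theorem turn_scPoint_left (k r i j : ℕ) (u v : ℂ) : turn (scPoint k r i j) u v =
    (1 - (j / r : ℝ)) * turn (gonPoint k i) u v + (j / r : ℝ) * turn (gonPoint k (i + 1)) u v := by
  simp only [turn_rotate _ u v, turn_scPoint]

theorem turn_scPoint_scPoint (k r i j j' : ℕ) (u : ℂ) :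
    turn (scPoint k r i j) (scPoint k r i j') u =
      ((j' - j : ℝ) / r) * turn (gonPoint k i) (gonPoint k (i + 1)) u := by
  simp only [turn_scPoint_left, turn_scPoint_mid, turn_self]
  rw [turn_swap (gonPoint k i) (gonPoint k (i + 1))]
  ring

theorem ratio_bounds {r j : ℕ} (hj : j < r) : 0 ≤ (j / r : ℝ) ∧ 0 < 1 - (j / r : ℝ) := by
  have h₁ : (j : ℝ) < r := by exact_mod_cast hj
  have h₀ : (0 : ℝ) < r := lt_of_le_of_lt (by positivity) h₁
  have := (div_lt_one h₀).2 h₁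
  exact ⟨by positivity, by linarith⟩

/-- Three points of `SC(k,r)` in cyclic order make a strict clockwise turn unless they are on one
side. -/
theorem turn_scLabel_pos {k r a b c : ℕ} (hk : 3 ≤ k) (hab : a < b) (hbc : b < c)
    (hc : c < k * r) (hf : ¬ IsFlat k r a b c) :
    0 < turn (scLabel k r a) (scLabel k r b) (scLabel k r c) := by
  have hr : 0 < r := Nat.pos_of_ne_zero (by rintro rfl; simp at hc)
  obtain ⟨ia, ja, hja, rfl⟩ : ∃ i j, j < r ∧ a = i * r + j :=
    ⟨a / r, a % r, Nat.mod_lt _ hr, by rw [mul_comm, Nat.div_add_mod]⟩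
  obtain ⟨ib, jb, hjb, rfl⟩ : ∃ i j, j < r ∧ b = i * r + j :=
    ⟨b / r, b % r, Nat.mod_lt _ hr, by rw [mul_comm, Nat.div_add_mod]⟩
  obtain ⟨ic, jc, hjc, rfl⟩ : ∃ i j, j < r ∧ c = i * r + j :=
    ⟨c / r, c % r, Nat.mod_lt _ hr, by rw [mul_comm, Nat.div_add_mod]⟩
  rw [scLabel_add hr hja.le, scLabel_add hr hjb.le, scLabel_add hr hjc.le]
  have hic : ic < k := by
    by_contra h
    have := Nat.mul_le_mul_right r (not_lt.1 h)
    omega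
  have hiab : ia ≤ ib := by
    by_contra h
    have := Nat.mul_le_mul_right r (not_le.1 h)
    rw [Nat.succ_mul] at this
    omega
  have hibc : ib ≤ ic := by
    by_contra h
    have := Nat.mul_le_mul_right r (not_le.1 h)
    rw [Nat.succ_mul] at this
    omega
  have la := ratio_bounds hja
  have lb := ratio_bounds hjb
  have lc := ratio_bounds hjc
  have pos_ratio {j : ℕ} (h : j ≠ 0) : 0 < (j / r : ℝ) := by positivity
  rcases eq_or_lt_of_le hiab with rfl | hiab
  · rw [turn_scPoint_scPoint, turn_scPoint]
    have hlt : (ja : ℝ) < jb := by exact_mod_cast (by omega : ja < jb)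
    have h₀ : 0 < (jb - ja : ℝ) / r := div_pos (by linarith) (by positivity)
    rcases eq_or_lt_of_le hibc with rfl | hibc
    · exact (hf (.inl ⟨ia, by omega, by rw [add_one_mul]; omega⟩)).elim
    refine mul_pos h₀ ?_
    have n₁ := turn_gonPoint_nonneg (Nat.le_succ ia) hibc hic.le
    have n₂ := turn_gonPoint_nonneg (n := k) (Nat.le_succ ia)
      (show ia + 1 ≤ ic + 1 by omega) (by omega)
    rcases eq_or_lt_of_le (show ia + 1 ≤ ic from hibc) with rfl | hlt
    · have hjc0 : jc ≠ 0 := by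
        rintro rfl
        exact hf (.inl ⟨ia, by omega, by omega⟩)
      have := turn_gonPoint_pos (n := k) (Nat.lt_succ_self ia)
        (show ia + 1 < ia + 1 + 1 by omega) (by omega)
      have := mul_pos (pos_ratio hjc0) this
      have := mul_nonneg lc.2.le n₁
      linarith
    · have := turn_gonPoint_pos (n := k) (Nat.lt_succ_self ia) hlt (by omega)
      have := mul_pos lc.2 this
      have := mul_nonneg lc.1 n₂
      linarith
  rcases eq_or_lt_of_le hibc with rfl | hibc
  · rw [turn_rotate, turn_scPoint_scPoint, turn_scPoint]
    have hlt : (jb : ℝ) < jc := by exact_mod_cast (by omega : jb < jc)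
    have h₀ : 0 < (jc - jb : ℝ) / r := div_pos (by linarith) (by positivity)
    refine mul_pos h₀ ?_
    simp only [← turn_rotate (gonPoint k _) (gonPoint k ib) (gonPoint k (ib + 1))]
    have n₁ := turn_gonPoint_nonneg hiab.le (Nat.le_succ ib) hic
    have n₂ := turn_gonPoint_nonneg (n := k) (show ia + 1 ≤ ib from hiab) (Nat.le_succ ib) hic
    -- With `b, c` on the last side, vertex 0 is collinear with them. Positivity then comes from
    -- vertex 1, whose weight is nonzero because `ja ≠ 0`.
    by_cases hw : ia = 0 ∧ ib + 1 = k
    · have hja0 : ja ≠ 0 := by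
        rintro rfl
        refine hf (.inr ⟨by simp [hw.1], ?_⟩)
        rw [← hw.2, Nat.add_sub_cancel]
        omega
      have := turn_gonPoint_pos (n := k) (show ia + 1 < ib by omega) (Nat.lt_succ_self ib)
        (by omega)
      have := mul_pos (pos_ratio hja0) this
      have := mul_nonneg la.2.le n₁
      linarith
    · have := turn_gonPoint_pos (n := k) hiab (Nat.lt_succ_self ib) (by omega)
      have := mul_pos la.2 this
      have := mul_nonneg la.1 n₂
      linarith
  have hn : ∀ x y z, x ≤ ia + 1 → ia ≤ x → y ≤ ib + 1 → ib ≤ y → z ≤ ic + 1 → ic ≤ z →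
      0 ≤ turn (gonPoint k x) (gonPoint k y) (gonPoint k z) := by
    intro x y z _ _ _ _ _ _
    exact turn_gonPoint_nonneg (by omega) (by omega) (by omega)
  have hp := turn_gonPoint_pos (n := k) hiab hibc (by omega)
  rw [turn_scPoint_left, turn_scPoint_mid, turn_scPoint, turn_scPoint, turn_scPoint_mid,
    turn_scPoint, turn_scPoint]
  have h1 := hn ia ib (ic + 1) (by omega) (by omega) (by omega) (by omega) (by omega) (by omega)
  have h2 := hn ia (ib + 1) ic (by omega) (by omega) (by omega) (by omega) (by omega) (by omega)
  have h3 := hn ia (ib + 1) (ic + 1) (by omega) (by omega) (by omega) (by omega) (by omega)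
    (by omega)
  have h4 := hn (ia + 1) ib ic (by omega) (by omega) (by omega) (by omega) (by omega) (by omega)
  have h5 := hn (ia + 1) ib (ic + 1) (by omega) (by omega) (by omega) (by omega) (by omega)
    (by omega)
  have h6 := hn (ia + 1) (ib + 1) ic (by omega) (by omega) (by omega) (by omega) (by omega)
    (by omega)
  have h7 := hn (ia + 1) (ib + 1) (ic + 1) (by omega) (by omega) (by omega) (by omega) (by omega)
    (by omega)
  obtain ⟨la, la'⟩ := la
  obtain ⟨lb, lb'⟩ := lb
  obtain ⟨lc, lc'⟩ := lc
  generalize 1 - (ja / r : ℝ) = a' at *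
  generalize 1 - (jb / r : ℝ) = b' at *
  generalize 1 - (jc / r : ℝ) = c' at *
  generalize (ja / r : ℝ) = a at *
  generalize (jb / r : ℝ) = b at *
  generalize (jc / r : ℝ) = c at *
  -- Of the eight terms of the trilinear expansion, the one at the initial vertices of the three
  -- distinct sides is positive and the others are nonnegative.
  apply add_pos_of_pos_of_nonneg
  · refine mul_pos la' (add_pos_of_pos_of_nonneg (mul_pos lb' ?_) (by positivity))
    exact add_pos_of_pos_of_nonneg (mul_pos lc' hp) (by positivity)
  · positivity

/-- Along each side some linear function is strictly increasing. -/
theorem exists_turn_strictMono {k r a c : ℕ} (hk : 3 ≤ k) (hr : 0 < r) (h : SameSide r a c) :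
    ∃ u v, ∀ x y, a ≤ x → x < y → y ≤ c →
      turn u v (scLabel k r x) < turn u v (scLabel k r y) := by
  obtain ⟨i, hi, hc⟩ := h
  -- The signed distance from the line through vertices `i + 2` and `i` is zero at vertex `i` and
  -- positive at vertex `i + 1`.
  refine ⟨gonPoint k (i + 2), gonPoint k i, fun x y hx hxy hy => ?_⟩
  rw [add_one_mul] at hc
  obtain ⟨j, rfl⟩ := Nat.exists_eq_add_of_le (hi.trans hx)
  obtain ⟨j', rfl⟩ := Nat.exists_eq_add_of_le (hi.trans (hx.trans hxy.le))
  rw [scLabel_add hr (by omega), scLabel_add hr (by omega), turn_scPoint, turn_scPoint,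
    turn_self_right, ← turn_rotate]
  have := turn_gonPoint_pos (n := k) (Nat.lt_succ_self i) (show i + 1 < i + 2 by omega) (by omega)
  rw [turn_rotate, turn_rotate] at this
  have hj : (j : ℝ) < j' := by exact_mod_cast (by omega : j < j')
  have hr' : (0 : ℝ) < r := by exact_mod_cast hr
  have := mul_lt_mul_of_pos_right (div_lt_div_of_pos_right hj hr') this
  rw [turn_rotate (gonPoint k (i + 1))]
  simpa using this

/-! Plane graphs on `SC(k,r)` as sets of non-crossing chords -/

theorem SameSide.mono {r a b a' b' : ℕ} (h : SameSide r a b) (ha : a ≤ a') (hb : b' ≤ b) :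
    SameSide r a' b' := by
  obtain ⟨i, h₁, h₂⟩ := h
  exact ⟨i, h₁.trans ha, hb.trans h₂⟩

theorem SameSide.trans {r a b c d : ℕ} (h : SameSide r a b) (h' : SameSide r c d)
    (hcb : c < b) : SameSide r a d := by
  obtain ⟨i, h₁, h₂⟩ := h
  obtain ⟨i', h₁', h₂'⟩ := h'
  have hi : i' ≤ i := by
    have : i' * r < (i + 1) * r := by omega
    have := lt_of_mul_lt_mul_right this (Nat.zero_le r)
    omega
  exact ⟨i, h₁, h₂'.trans (Nat.mul_le_mul_right _ (by omega))⟩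

theorem SameSide.le_of_zero {r b : ℕ} (hr : 0 < r) (h : SameSide r 0 b) : b ≤ r := by
  obtain ⟨i, h₁, h₂⟩ := h
  obtain rfl : i = 0 := by
    by_contra hi
    have := Nat.mul_pos (Nat.pos_of_ne_zero hi) hr
    omega
  omega

theorem sameSide_last {k r : ℕ} (hk : 0 < k) : SameSide r ((k - 1) * r) (k * r) :=
  ⟨k - 1, le_rfl, by rw [Nat.sub_add_cancel hk]⟩

theorem mul_eq_pred_mul_add {k : ℕ} (hk : 0 < k) (r : ℕ) : k * r = (k - 1) * r + r := by
  rw [← add_one_mul, show k - 1 + 1 = k by omega]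

theorem two_mul_le_pred_mul {k : ℕ} (hk : 3 ≤ k) (r : ℕ) : 2 * r ≤ (k - 1) * r :=
  Nat.mul_le_mul_right _ (by omega)

section

variable {k r a b c d : ℕ}

theorem scLabel_ne_of_sameSide (hk : 3 ≤ k) (hr : 0 < r) (h : SameSide r a b) (hb : a < b) :
    scLabel k r a ≠ scLabel k r b := by
  obtain ⟨u, v, huv⟩ := exists_turn_strictMono hk hr h
  intro he
  have := huv a b le_rfl hb le_rfl
  rw [he] at this
  exact lt_irrefl _ this

theorem turn_eq_zero_of_sameSide (hr : 0 < r) (h : SameSide r a c) (hab : a ≤ b) (hbc : b ≤ c) :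
    turn (scLabel k r a) (scLabel k r b) (scLabel k r c) = 0 := by
  obtain ⟨i, hi, hc⟩ := h
  rw [add_one_mul] at hc
  obtain ⟨x, rfl⟩ := Nat.exists_eq_add_of_le hi
  obtain ⟨y, rfl⟩ := Nat.exists_eq_add_of_le (hi.trans hab)
  obtain ⟨z, rfl⟩ := Nat.exists_eq_add_of_le (hi.trans (hab.trans hbc))
  rw [scLabel_add hr (by omega), scLabel_add hr (by omega), scLabel_add hr (by omega),
    turn_scPoint_scPoint, turn_scPoint, turn_self_left, turn_self_right]
  ring

theorem turn_eq_zero_of_isFlat (hk : 3 ≤ k) (h : IsFlat k r a b c) (hab : a < b) (hbc : b < c)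
    (hc : c < k * r) : turn (scLabel k r a) (scLabel k r b) (scLabel k r c) = 0 := by
  have hr : 0 < r := Nat.pos_of_ne_zero (by rintro rfl; simp at hc)
  rcases h with h | ⟨rfl, h⟩
  · exact turn_eq_zero_of_sameSide hr h hab.le hbc.le
  · rw [← scLabel_self (by omega) hr, turn_rotate]
    exact turn_eq_zero_of_sameSide hr ((sameSide_last (by omega)).mono h le_rfl) hbc.le hc.le

theorem turn_scLabel_nonneg (hk : 3 ≤ k) (hab : a < b) (hbc : b < c) (hc : c < k * r) :
    0 ≤ turn (scLabel k r a) (scLabel k r b) (scLabel k r c) := by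
  by_cases h : IsFlat k r a b c
  · exact (turn_eq_zero_of_isFlat hk h hab hbc hc).ge
  · exact (turn_scLabel_pos hk hab hbc hc h).le

theorem scLabel_ne (hk : 3 ≤ k) (hab : a < b) (hb : b < k * r) :
    scLabel k r a ≠ scLabel k r b := by
  have hr : 0 < r := Nat.pos_of_ne_zero (by rintro rfl; simp at hb)
  have hK := mul_eq_pred_mul_add (show 0 < k by omega) r
  have hK' := two_mul_le_pred_mul hk r
  have hlast := sameSide_last (k := k) (r := r) (by omega)
  by_cases h : SameSide r a b
  · exact scLabel_ne_of_sameSide hk hr h hab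
  by_cases h' : a = 0 ∧ (k - 1) * r ≤ b
  · obtain ⟨rfl, h'⟩ := h'
    rw [← scLabel_self (by omega) hr]
    exact (scLabel_ne_of_sameSide hk hr (hlast.mono h' le_rfl) hb).symm
  intro he
  -- Coinciding points have zero turn with any third point. The third point is `b + 1`, or 0 if `b`
  -- is the last label.
  by_cases hb' : b + 1 < k * r
  · have := turn_scLabel_pos hk hab (Nat.lt_succ_self b) hb' (by
      rintro (hf | hf)
      · exact h (hf.mono le_rfl (by omega))
      · exact h' hf)
    rw [he, turn_self] at this
    exact lt_irrefl _ this
  · have := turn_scLabel_pos (a := 0) hk (show 0 < a by omega) hab hb (by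
      rintro (hf | hf)
      · have := hf.le_of_zero hr
        omega
      · exact h (hlast.mono hf.2 hb.le))
    rw [he, turn_self_right] at this
    exact lt_irrefl _ this

theorem scLabel_mem_openSegment (hr : 0 < r) (h : SameSide r a c) (hab : a < b) (hbc : b < c) :
    scLabel k r b ∈ openSegment ℝ (scLabel k r a) (scLabel k r c) := by
  obtain ⟨i, hi, hc⟩ := h
  rw [add_one_mul] at hc
  obtain ⟨x, rfl⟩ := Nat.exists_eq_add_of_le hi
  obtain ⟨y, rfl⟩ := Nat.exists_eq_add_of_le (hi.trans hab.le)
  obtain ⟨z, rfl⟩ := Nat.exists_eq_add_of_le (hi.trans (hab.trans hbc).le)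
  rw [scLabel_add hr (by omega), scLabel_add hr (by omega), scLabel_add hr (by omega)]
  have h₁ : (x : ℝ) < y := by exact_mod_cast (by omega : x < y)
  have h₂ : (y : ℝ) < z := by exact_mod_cast (by omega : y < z)
  have h₀ : (z - x : ℝ) ≠ 0 := by linarith
  have hr' : (r : ℝ) ≠ 0 := by positivity
  refine ⟨(z - y) / (z - x), (y - x) / (z - x), div_pos (by linarith) (by linarith),
    div_pos (by linarith) (by linarith), by field_simp; ring, ?_⟩
  simp only [scPoint_eq_combination, smul_add, smul_smul]
  rw [add_add_add_comm, ← add_smul, ← add_smul]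
  congr 2 <;> field_simp <;> ring

/-- A point off the line of the chord is excluded by a nonzero turn, a point on it by the monotone
function along the side, with 0 read as `k * r` on the last side. -/
theorem disjoint_openSegment_SC_iff (hk : 3 ≤ k) (hab : a < b) (hb : b < k * r) :
    Disjoint (openSegment ℝ (scLabel k r a) (scLabel k r b)) (SC k r) ↔ ¬ BadChord k r a b := by
  have hr : 0 < r := Nat.pos_of_ne_zero (by rintro rfl; simp at hb)
  have hK := mul_eq_pred_mul_add (show 0 < k by omega) r
  have hK' := two_mul_le_pred_mul hk r
  have hlast := sameSide_last (k := k) (r := r) (by omega)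
  constructor
  · rintro hd ⟨h2, h | ⟨rfl, h, h'⟩⟩
    · exact Set.disjoint_left.1 hd
        (scLabel_mem_openSegment hr h (Nat.lt_succ_self a) (by omega))
        (mem_SC_iff.2 ⟨a + 1, by omega, rfl⟩)
    · refine Set.disjoint_left.1 hd ?_ (mem_SC_iff.2 ⟨b + 1, by omega, rfl⟩)
      rw [openSegment_symm, ← scLabel_self (by omega) hr]
      exact scLabel_mem_openSegment hr (hlast.mono h le_rfl) (Nat.lt_succ_self b) (by omega)
  · intro hA
    rw [Set.disjoint_right]
    intro z hz
    obtain ⟨c, hc, rfl⟩ := mem_SC_iff.1 hz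
    rcases lt_trichotomy c a with hca | rfl | hac
    · by_cases hf : IsFlat k r c a b
      · rcases hf with hf | ⟨rfl, hf⟩
        · obtain ⟨u, v, huv⟩ := exists_turn_strictMono hk hr hf
          exact notMem_openSegment_of_lt (huv _ _ le_rfl hca (by omega))
            (huv _ _ hca.le hab (by omega))
        · obtain ⟨u, v, huv⟩ := exists_turn_strictMono hk hr (hlast.mono hf le_rfl)
          rw [← scLabel_self (by omega) hr]
          exact notMem_openSegment_of_gt (huv _ _ le_rfl hab (by omega))
            (huv _ _ hab.le hb le_rfl)
      · apply notMem_openSegment_of_turn_ne_zero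
        rw [← turn_rotate]
        exact (turn_scLabel_pos hk hca hab hb hf).ne'
    · rw [left_mem_openSegment_iff]
      exact scLabel_ne hk hab hb
    rcases lt_trichotomy c b with hcb | rfl | hbc
    · by_cases hf : IsFlat k r a c b
      · rcases hf with hf | ⟨rfl, hf⟩
        · exact (hA ⟨by omega, .inl hf⟩).elim
        · obtain ⟨u, v, huv⟩ := exists_turn_strictMono hk hr (hlast.mono hf le_rfl)
          rw [openSegment_symm, ← scLabel_self (by omega) hr]
          exact notMem_openSegment_of_lt (huv _ _ le_rfl hcb (by omega))
            (huv _ _ hcb.le hb le_rfl)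
      · apply notMem_openSegment_of_turn_ne_zero
        rw [turn_flip, neg_ne_zero]
        exact (turn_scLabel_pos hk hac hcb hb hf).ne'
    · rw [right_mem_openSegment_iff]
      exact scLabel_ne hk hab hb
    · by_cases hf : IsFlat k r a b c
      · rcases hf with hf | ⟨rfl, hf⟩
        · obtain ⟨u, v, huv⟩ := exists_turn_strictMono hk hr hf
          exact notMem_openSegment_of_gt (huv _ _ le_rfl hab (by omega))
            (huv _ _ hab.le hbc (by omega))
        · exact (hA ⟨by omega, .inr ⟨rfl, hf, by omega⟩⟩).elim
      · exact notMem_openSegment_of_turn_ne_zero (turn_scLabel_pos hk hab hbc hc hf).ne'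

/-- The quadrilateral `a, c, b, d` is strictly convex: a flat triple among its corners would make
one of the two chords bad. -/
theorem not_disjoint_of_crossing (hk : 3 ≤ k) (hac : a < c) (hcb : c < b) (hbd : b < d)
    (hd : d < k * r) (hab : ¬ BadChord k r a b) (hcd : ¬ BadChord k r c d) :
    ¬ Disjoint (openSegment ℝ (scLabel k r a) (scLabel k r b))
      (openSegment ℝ (scLabel k r c) (scLabel k r d)) := by
  have h₁ : ¬ SameSide r a b := fun h => hab ⟨by omega, .inl h⟩
  have h₂ : ¬ SameSide r c d := fun h => hcd ⟨by omega, .inl h⟩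
  have h₃ : ¬ (a = 0 ∧ (k - 1) * r ≤ b) := fun h => hab ⟨by omega, .inr ⟨h.1, h.2, by omega⟩⟩
  refine not_disjoint_openSegment
    (turn_scLabel_pos hk hac hcb (by omega) ?_) (turn_scLabel_pos hk (by omega) hbd hd ?_)
    (turn_scLabel_pos hk hac (by omega) hd ?_) (turn_scLabel_pos hk hcb hbd hd ?_)
  · rintro (h | h)
    exacts [h₁ h, h₃ ⟨h.1, by omega⟩]
  · rintro (h | h)
    exacts [h₁ (h.mono le_rfl hbd.le), h₃ h]
  · rintro (h | h)
    exacts [h₁ (h.mono le_rfl hbd.le), h₃ ⟨h.1, by omega⟩]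
  · rintro (h | h)
    exacts [h₂ h, by omega]

theorem disjoint_of_nested (hk : 3 ≤ k) (hac : a ≤ c) (hcd : c < d) (hdb : d ≤ b)
    (hb : b < k * r) (hab : ¬ BadChord k r a b) (hcd' : ¬ BadChord k r c d)
    (hne : ¬ (a = c ∧ b = d)) :
    Disjoint (openSegment ℝ (scLabel k r a) (scLabel k r b))
      (openSegment ℝ (scLabel k r c) (scLabel k r d)) := by
  have hr : 0 < r := Nat.pos_of_ne_zero (by rintro rfl; simp at hb)
  have hK := mul_eq_pred_mul_add (show 0 < k by omega) r
  have hK' := two_mul_le_pred_mul hk r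
  have hlast := sameSide_last (k := k) (r := r) (by omega)
  have h₁ : ¬ SameSide r a b := fun h => hab ⟨by omega, .inl h⟩
  have np : ∀ m, a ≤ m → m ≤ b → turn (scLabel k r a) (scLabel k r b) (scLabel k r m) ≤ 0 := by
    intro m h h'
    rcases eq_or_lt_of_le h with rfl | h
    · rw [turn_self_left]
    rcases eq_or_lt_of_le h' with rfl | h'
    · rw [turn_self_right]
    rw [turn_flip, neg_nonpos]
    exact turn_scLabel_nonneg hk h h' hb
  have ng : ∀ m, a < m → m < b → ¬ IsFlat k r a m b →
      turn (scLabel k r a) (scLabel k r b) (scLabel k r m) < 0 := by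
    intro m h h' hf
    rw [turn_flip, neg_lt_zero]
    exact turn_scLabel_pos hk h h' hb hf
  -- In this case `a = 0`, read as `k * r`, and both chords lie on the line of the last side, one
  -- after the other.
  by_cases hs : a < c ∧ IsFlat k r a c b
  · obtain ⟨hac, hf | ⟨rfl, hf⟩⟩ := hs
    · exact (h₁ hf).elim
    obtain ⟨u, v, huv⟩ := exists_turn_strictMono hk hr (hlast.mono hf le_rfl)
    rw [openSegment_symm, ← scLabel_self (by omega) hr]
    refine (disjoint_openSegment_of_separated (huv c d le_rfl hcd (by omega)) ?_
      (huv b _ (by omega) hb le_rfl)).symm.mono_left ?_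
    · rcases eq_or_lt_of_le hdb with rfl | hdb
      · exact le_rfl
      · exact (huv d b (by omega) hdb (by omega)).le
    · rw [openSegment_symm]
  · apply disjoint_openSegment_of_turn_neg (np c hac (by omega)) (np d (by omega) hdb)
    by_cases hac' : a < c
    · exact .inl (ng c hac' (by omega) fun h => hs ⟨hac', h⟩)
    · obtain rfl : a = c := by omega
      refine .inr (ng d hcd (by omega) ?_)
      rintro (h | h)
      · exact h₁ h
      · exact hcd' ⟨by omega, .inr ⟨h.1, h.2, by omega⟩⟩

theorem disjoint_of_consecutive (hk : 3 ≤ k) (hab : a < b) (hbc : b ≤ c) (hcd : c < d)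
    (hd : d < k * r) (hab' : ¬ BadChord k r a b) :
    Disjoint (openSegment ℝ (scLabel k r a) (scLabel k r b))
      (openSegment ℝ (scLabel k r c) (scLabel k r d)) := by
  have hr : 0 < r := Nat.pos_of_ne_zero (by rintro rfl; simp at hd)
  have hK := mul_eq_pred_mul_add (show 0 < k by omega) r
  have hK' := two_mul_le_pred_mul hk r
  by_cases hf : IsFlat k r a b d
  · rcases hf with hf | hf
    · obtain ⟨u, v, huv⟩ := exists_turn_strictMono hk hr hf
      refine disjoint_openSegment_of_separated (huv a b le_rfl hab (by omega)) ?_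
        (huv c d (by omega) hcd le_rfl)
      rcases eq_or_lt_of_le hbc with rfl | hbc
      · exact le_rfl
      · exact (huv b c (by omega) hbc (by omega)).le
    · exact (hab' ⟨by omega, .inr ⟨hf.1, hf.2, by omega⟩⟩).elim
  · refine disjoint_openSegment_of_turn_pos ?_ (turn_scLabel_nonneg hk hab (by omega) hd)
      (.inr (turn_scLabel_pos hk hab (by omega) hd hf))
    rcases eq_or_lt_of_le hbc with rfl | hbc
    · rw [turn_self_right]
    · exact turn_scLabel_nonneg hk hab hbc (by omega)

theorem disjoint_of_not_crossing (hk : 3 ≤ k) (hab : a < b) (hb : b < k * r) (hcd : c < d)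
    (hd : d < k * r) (hab' : ¬ BadChord k r a b) (hcd' : ¬ BadChord k r c d)
    (hne : ¬ (a = c ∧ b = d)) (h₁ : ¬ (a < c ∧ c < b ∧ b < d)) (h₂ : ¬ (c < a ∧ a < d ∧ d < b)) :
    Disjoint (openSegment ℝ (scLabel k r a) (scLabel k r b))
      (openSegment ℝ (scLabel k r c) (scLabel k r d)) := by
  rcases le_or_gt b c with h | h
  · exact disjoint_of_consecutive hk hab h hcd hd hab'
  rcases le_or_gt d a with h' | h'
  · exact (disjoint_of_consecutive hk hcd h' hab hb hcd').symm
  by_cases hn : a ≤ c ∧ d ≤ b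
  · exact disjoint_of_nested hk hn.1 hcd hn.2 hb hab' hcd' hne
  · exact (disjoint_of_nested hk (by omega) hab (by omega) hd hcd' hab' (by omega)).symm

/-- If `(m, b)` is bad with `m > 0`, then `m` and `b` share a side, so all longer chords from `m` up
to `b` are bad too. If `(a, m + 1)` were bad, `(a, b)` or `(a, m)` would be as well. -/
theorem isAdmissible_badChord (hk : 3 ≤ k) (hr : 0 < r) :
    IsAdmissible (fun a b => ¬ BadChord k r a b) 0 (k * r - 1) := by
  have hK := mul_eq_pred_mul_add (show 0 < k by omega) r
  have hK' := two_mul_le_pred_mul hk r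
  constructor
  · rintro a ⟨h, -⟩
    omega
  · rintro ⟨h, h' | h'⟩
    · have := h'.le_of_zero hr
      omega
    · omega
  · rintro a m b - ham hmb hb hab hAm hmb'
    obtain ⟨h2, hS | hS⟩ := not_not.1 hmb'
    swap
    · omega
    refine ⟨?_, fun d hd hdb h => h ⟨by omega, .inl (hS.mono le_rfl hdb)⟩⟩
    rintro ⟨h2', h | ⟨rfl, h, h'⟩⟩
    · exact hab ⟨by omega, .inl (h.trans hS (by omega))⟩
    · refine hAm ⟨?_, .inr ⟨rfl, ?_, by omega⟩⟩
      · omega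
      · obtain ⟨i, hi, hi'⟩ := hS
        have : k - 1 < i + 1 := lt_of_mul_lt_mul_right (show (k - 1) * r < (i + 1) * r by omega)
          (Nat.zero_le r)
        exact (Nat.mul_le_mul_right r (by omega)).trans hi

end

section

variable {k r : ℕ}

/-- The point of `SC(k,r)` with label `m`. -/
def scPt (m : ℕ) (hm : m < k * r) : SC k r := ⟨scLabel k r m, mem_SC_iff.2 ⟨m, hm, rfl⟩⟩

theorem exists_scPt (p : SC k r) : ∃ m, ∃ hm : m < k * r, p = scPt m hm := by
  obtain ⟨m, hm, h⟩ := mem_SC_iff.1 p.2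
  exact ⟨m, hm, Subtype.ext h⟩

theorem scPt_inj (hk : 3 ≤ k) {a b : ℕ} {ha : a < k * r} {hb : b < k * r} :
    scPt a ha = scPt b hb ↔ a = b := by
  constructor
  · intro h
    have h' : scLabel k r a = scLabel k r b := congrArg Subtype.val h
    rcases lt_trichotomy a b with hab | hab | hab
    · exact (scLabel_ne hk hab hb h').elim
    · exact hab
    · exact (scLabel_ne hk hab ha h'.symm).elim
  · rintro rfl
    rfl

open Classical in
/-- The edges of a graph on `SC(k,r)` as label pairs. -/
def chordSet (G : SimpleGraph (SC k r)) : Finset (ℕ × ℕ) :=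
  (Finset.range (k * r) ×ˢ Finset.range (k * r)).filter fun e =>
    e.1 < e.2 ∧ ∃ h₁ h₂, G.Adj (scPt e.1 h₁) (scPt e.2 h₂)

theorem mem_chordSet {G : SimpleGraph (SC k r)} {a b : ℕ} :
    (a, b) ∈ chordSet G ↔ a < b ∧ ∃ h₁ h₂, G.Adj (scPt a h₁) (scPt b h₂) := by
  simp only [chordSet, Finset.mem_filter, Finset.mem_product, Finset.mem_range]
  exact ⟨fun h => h.2, fun h => ⟨⟨h.2.1, h.2.2.1⟩, h⟩⟩

theorem exists_mem_chordSet {G : SimpleGraph (SC k r)} {p q : SC k r} (h : G.Adj p q) :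
    ∃ a b, ∃ (ha : a < k * r) (hb : b < k * r), (a, b) ∈ chordSet G ∧
      (p = scPt a ha ∧ q = scPt b hb ∨ p = scPt b hb ∧ q = scPt a ha) := by
  obtain ⟨a, ha, rfl⟩ := exists_scPt p
  obtain ⟨b, hb, rfl⟩ := exists_scPt q
  rcases lt_trichotomy a b with hab | rfl | hab
  · exact ⟨a, b, ha, hb, mem_chordSet.2 ⟨hab, ha, hb, h⟩, .inl ⟨rfl, rfl⟩⟩
  · exact (G.irrefl h).elim
  · exact ⟨b, a, hb, ha, mem_chordSet.2 ⟨hab, hb, ha, h.symm⟩, .inr ⟨rfl, rfl⟩⟩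

theorem chordSet_subset_iff {G G' : SimpleGraph (SC k r)} :
    chordSet G ⊆ chordSet G' ↔ G ≤ G' := by
  constructor
  · intro h p q hpq
    obtain ⟨a, b, ha, hb, hab, ⟨rfl, rfl⟩ | ⟨rfl, rfl⟩⟩ := exists_mem_chordSet hpq
    · exact (mem_chordSet.1 (h hab)).2.2.2
    · exact (mem_chordSet.1 (h hab)).2.2.2.symm
  · rintro h ⟨a, b⟩ hab
    rw [mem_chordSet] at hab ⊢
    exact ⟨hab.1, hab.2.1, hab.2.2.1, h hab.2.2.2⟩

theorem chordSet_injective : Function.Injective (chordSet (k := k) (r := r)) := fun _ _ h =>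
  le_antisymm (chordSet_subset_iff.1 h.subset) (chordSet_subset_iff.1 h.symm.subset)

theorem exists_chordSet_eq (hk : 3 ≤ k) {T : Finset (ℕ × ℕ)}
    (hT : ∀ a b, (a, b) ∈ T → a < b ∧ b < k * r) :
    ∃ G : SimpleGraph (SC k r), chordSet G = T := by
  refine ⟨SimpleGraph.fromRel fun p q => ∃ a b, ∃ (ha : a < k * r) (hb : b < k * r),
    (a, b) ∈ T ∧ p = scPt a ha ∧ q = scPt b hb, ?_⟩
  ext ⟨a, b⟩
  rw [mem_chordSet]
  constructor
  · rintro ⟨hab, ha, hb, -, ⟨a', b', ha', hb', h, h₁, h₂⟩ | ⟨a', b', ha', hb', h, h₁, h₂⟩⟩ <;>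
      rw [scPt_inj hk] at h₁ h₂ <;> subst h₁ h₂
    · exact h
    · have := (hT _ _ h).1
      omega
  · intro h
    obtain ⟨hab, hb⟩ := hT a b h
    refine ⟨hab, hab.trans hb, hb, ?_, .inl ⟨a, b, hab.trans hb, hb, h, rfl, rfl⟩⟩
    rw [Ne, scPt_inj hk]
    exact hab.ne

theorem isPlaneGraph_iff (hk : 3 ≤ k) {G : SimpleGraph (SC k r)} :
    IsPlaneGraph (SC k r) G ↔
      IsPlaneChords (fun a b => ¬ BadChord k r a b) 0 (k * r - 1) (chordSet G) := by
  constructor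
  · rintro ⟨h₁, h₂⟩
    have hA : ∀ a b, (a, b) ∈ chordSet G → ¬ BadChord k r a b := by
      intro a b hab
      obtain ⟨hab, ha, hb, hG⟩ := mem_chordSet.1 hab
      exact (disjoint_openSegment_SC_iff hk hab hb).1 (h₁ _ _ hG)
    refine ⟨fun _ _ _ => Nat.zero_le _, fun a b h => (mem_chordSet.1 h).1, ?_, hA, ?_⟩
    · intro a b hab
      have := (mem_chordSet.1 hab).2.2.1
      omega
    · intro a b c d hab hcd l₁ l₂ l₃
      obtain ⟨-, ha, hb, hG⟩ := mem_chordSet.1 hab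
      obtain ⟨-, hc, hd, hG'⟩ := mem_chordSet.1 hcd
      refine not_disjoint_of_crossing hk l₁ l₂ l₃ hd (hA _ _ hab) (hA _ _ hcd)
        (h₂ _ _ _ _ hG hG' ?_)
      rw [Ne, Sym2.eq_iff, scPt_inj hk, scPt_inj hk, scPt_inj hk, scPt_inj hk]
      omega
  · intro h
    constructor
    · intro p q hpq
      obtain ⟨a, b, ha, hb, hab, ⟨rfl, rfl⟩ | ⟨rfl, rfl⟩⟩ := exists_mem_chordSet hpq
      · exact (disjoint_openSegment_SC_iff hk (h.lt _ _ hab) hb).2 (h.allowed _ _ hab)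
      · rw [openSegment_symm]
        exact (disjoint_openSegment_SC_iff hk (h.lt _ _ hab) hb).2 (h.allowed _ _ hab)
    · have key : ∀ p q, G.Adj p q → ∃ a b, ∃ (ha : a < k * r) (hb : b < k * r),
          (a, b) ∈ chordSet G ∧ s(p, q) = s(scPt a ha, scPt b hb) ∧
          openSegment ℝ (p : ℂ) q = openSegment ℝ (scLabel k r a) (scLabel k r b) := by
        intro p q hpq
        obtain ⟨a, b, ha, hb, hab, ⟨rfl, rfl⟩ | ⟨rfl, rfl⟩⟩ := exists_mem_chordSet hpq
        · exact ⟨a, b, ha, hb, hab, rfl, rfl⟩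
        · exact ⟨a, b, ha, hb, hab, Sym2.eq_swap, openSegment_symm _ _ _⟩
      intro p q p' q' hpq hpq' hne
      obtain ⟨a, b, ha, hb, hab, e, e'⟩ := key p q hpq
      obtain ⟨c, d, hc, hd, hcd, f, f'⟩ := key p' q' hpq'
      rw [e', f']
      refine disjoint_of_not_crossing hk (h.lt _ _ hab) hb (h.lt _ _ hcd) hd (h.allowed _ _ hab)
        (h.allowed _ _ hcd) ?_ ?_ ?_
      · rintro ⟨rfl, rfl⟩
        exact hne (e.trans f.symm)
      · rintro ⟨l₁, l₂, l₃⟩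
        exact h.noncrossing _ _ _ _ hab hcd l₁ l₂ l₃
      · rintro ⟨l₁, l₂, l₃⟩
        exact h.noncrossing _ _ _ _ hcd hab l₁ l₂ l₃

theorem isTriangulation_iff (hk : 3 ≤ k) (hr : 0 < r) {G : SimpleGraph (SC k r)} :
    IsTriangulation (SC k r) G ↔
      IsChordTriang (fun a b => ¬ BadChord k r a b) 0 (k * r - 1) (chordSet G) := by
  have hn := Nat.mul_le_mul hk (show 1 ≤ r from hr)
  rw [← (isAdmissible_badChord hk hr).maximal_iff (by omega)]
  constructor
  · intro h
    refine ⟨(isPlaneGraph_iff hk).1 h.prop, fun T hT hle => ?_⟩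
    obtain ⟨G', rfl⟩ := exists_chordSet_eq (r := r) hk (T := T) fun a b hab =>
      ⟨hT.lt _ _ hab, by have := hT.upper _ _ hab; omega⟩
    exact chordSet_subset_iff.2 (h.le_of_ge ((isPlaneGraph_iff hk).2 hT)
      (chordSet_subset_iff.1 hle))
  · intro h
    refine ⟨(isPlaneGraph_iff hk).2 h.prop, fun G' hG' hle => ?_⟩
    exact chordSet_subset_iff.1 (h.le_of_ge ((isPlaneGraph_iff hk).1 hG')
      (chordSet_subset_iff.2 hle))

/-- The predicate `P` is left open so that one bijection serves both the triangulations of `SC(k,r)`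
and, with subdivision number 1, the legal triangulations of a convex polygon. -/
theorem card_eq_card_chordTriangs (hk : 3 ≤ k) {A : ℕ → ℕ → Prop}
    {P : SimpleGraph (SC k r) → Prop} (hk0 : 0 < k * r)
    (hP : ∀ G, P G ↔ IsChordTriang A 0 (k * r - 1) (chordSet G)) :
    Nat.card {G : SimpleGraph (SC k r) // P G} = (chordTriangs A 0 (k * r - 1)).card := by
  rw [← Nat.card_eq_finsetCard]
  refine Nat.card_eq_of_bijective
    (fun G => ⟨chordSet G.1, mem_chordTriangs.2 ((hP G.1).1 G.2)⟩) ⟨?_, ?_⟩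
  · rintro ⟨G, hG⟩ ⟨G', hG'⟩ h
    exact Subtype.ext (chordSet_injective (congrArg Subtype.val h))
  · rintro ⟨T, hT⟩
    rw [mem_chordTriangs] at hT
    obtain ⟨G, rfl⟩ := exists_chordSet_eq (r := r) hk (T := T) fun a b hab =>
      ⟨hT.lt _ _ hab, by have := hT.upper _ _ hab; omega⟩
    exact ⟨⟨G, (hP G).2 hT⟩, rfl⟩

theorem numTriangulations_SC (hk : 3 ≤ k) (hr : 0 < r) : numTriangulations (SC k r) =
    (chordTriangs (fun a b => ¬ BadChord k r a b) 0 (k * r - 1)).card :=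
  card_eq_card_chordTriangs hk (by positivity) fun _ => isTriangulation_iff hk hr

end

/-! ### The convex polygon without forbidden diagonals -/

theorem not_badChord_one (n a b : ℕ) : ¬ BadChord n 1 a b := by
  rintro ⟨h, ⟨i, h₁, h₂⟩ | ⟨-, h₁, h₂⟩⟩ <;> omega

theorem scLabel_one (n m : ℕ) : scLabel n 1 m = gonPoint n m := by
  simp [scLabel, scPoint, Nat.mod_one]

/-- The last string ends at vertex `k * r`, which is vertex 0 again. There a forbidden pair has its
larger label first, whence the disjunction. -/
theorem isForbidden_iff {k r a b : ℕ} (hk : 2 ≤ k) (hr : 2 ≤ r) (hab : a < b) (hb : b < k * r) :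
    IsForbidden k r (gonPoint (k * r) a) (gonPoint (k * r) b) ∨
      IsForbidden k r (gonPoint (k * r) b) (gonPoint (k * r) a) ↔ BadChord k r a b := by
  have hn := Nat.mul_le_mul hk hr
  have h0 := gonPoint_self (n := k * r) (by omega)
  have inj : ∀ x y, x < k * r → y < k * r → gonPoint (k * r) x = gonPoint (k * r) y → x = y := by
    intro x y hx hy h
    -- The regular polygon is the case of subdivision number 1, where labels are already known to be
    -- injective.
    rw [← scPt_inj (k := k * r) (r := 1) (by omega) (ha := by omega) (hb := by omega)]
    apply Subtype.ext
    simpa [scPt, scLabel_one] using h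
  have hK := mul_eq_pred_mul_add (show 0 < k by omega) r
  have hlast : ∀ i, i < k → (i + 1) * r ≤ k * r := fun i hi => Nat.mul_le_mul_right _ hi
  constructor
  · rintro (⟨i, j, j', hi, hj, hj', e, e'⟩ | ⟨i, j, j', hi, hj, hj', e, e'⟩)
    · have := hlast i hi
      rw [add_one_mul] at this
      rcases eq_or_lt_of_le (show i * r + j' ≤ k * r by omega) with h | h
      · rw [h, h0] at e'
        have := inj _ _ hb (by omega) e'
        omega
      · have := inj _ _ (by omega) (by omega) e
        have := inj _ _ (by omega) h e'
        exact ⟨by omega, .inl ⟨i, by omega, by rw [add_one_mul]; omega⟩⟩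
    · have := hlast i hi
      rw [add_one_mul] at this
      rcases eq_or_lt_of_le (show i * r + j' ≤ k * r by omega) with h | h
      · rw [h, h0] at e'
        have e₁ := inj _ _ (by omega) (by omega) e'
        have e₂ := inj _ _ (by omega) (by omega) e
        have hi' : (k - 1) * r ≤ i * r := by omega
        refine ⟨?_, .inr ⟨e₁, by omega, by omega⟩⟩
        have : 1 * r ≤ (k - 1) * r := Nat.mul_le_mul_right r (by omega)
        omega
      · have := inj _ _ (by omega) (by omega) e
        have := inj _ _ (by omega) h e'
        omega
  · rintro ⟨h2, ⟨i, hi, hi'⟩ | ⟨rfl, h, h'⟩⟩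
    · left
      refine ⟨i, a - i * r, b - i * r, ?_, by omega, ?_, by congr 1; omega, by congr 1; omega⟩
      · exact lt_of_mul_lt_mul_right (show i * r < k * r by omega) (Nat.zero_le r)
      · rw [add_one_mul] at hi'
        omega
    · right
      refine ⟨k - 1, b - (k - 1) * r, r, by omega, by omega, le_rfl, by congr 1; omega, ?_⟩
      rw [← hK, h0]

/-- The `kr`-gon is `SC(kr, 1)`, where no chord is bad, so its triangulations are all chord
triangulations and legality is the remaining restriction. This reaches `k = 2`. -/
theorem numLegal_eq {k r : ℕ} (hk : 2 ≤ k) (hr : 2 ≤ r) : numLegal k r =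
    (chordTriangs (fun a b => ¬ BadChord k r a b) 0 (k * r - 1)).card := by
  have hn := Nat.mul_le_mul hk hr
  have h3 : 3 ≤ k * r := by omega
  rw [numLegal, ← SC_one, show k * r - 1 = k * r * 1 - 1 by simp]
  refine card_eq_card_chordTriangs h3 (by omega) fun G => ?_
  rw [isTriangulation_iff h3 one_pos, isChordTriang_iff_true,
    isChordTriang_iff_true (A := fun a b => ¬ BadChord k r a b)]
  have e : (∀ a b, (a, b) ∈ chordSet G → ¬ BadChord (k * r) 1 a b) := fun a b _ =>
    not_badChord_one _ _ _
  rw [and_iff_left e]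
  refine and_congr_right fun _ => ⟨fun h a b hab => ?_, fun h p q hpq hf => ?_⟩
  · obtain ⟨hlt, ha, hb, hG⟩ := mem_chordSet.1 hab
    rw [← isForbidden_iff hk hr hlt (by omega), not_or, ← scLabel_one, ← scLabel_one]
    exact ⟨h _ _ hG, h _ _ hG.symm⟩
  · obtain ⟨a, b, ha, hb, hab, ⟨rfl, rfl⟩ | ⟨rfl, rfl⟩⟩ := exists_mem_chordSet hpq
    · refine h a b hab ((isForbidden_iff hk hr (mem_chordSet.1 hab).1 (by omega)).1 (.inl ?_))
      rw [← scLabel_one, ← scLabel_one]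
      exact hf
    · refine h a b hab ((isForbidden_iff hk hr (mem_chordSet.1 hab).1 (by omega)).1 (.inr ?_))
      rw [← scLabel_one, ← scLabel_one]
      exact hf

/-- The number `tr(k,r)` as a number of triangulations by index pairs. -/
theorem tr_eq_card {k r : ℕ} (hk : 2 ≤ k) (hr : 2 ≤ r) :
    tr k r = (chordTriangs (fun a b => ¬ BadChord k r a b) 0 (k * r - 1)).card := by
  rcases eq_or_lt_of_le hk with rfl | hk
  · rw [← numLegal_eq le_rfl hr]
    simp [tr]
  · rw [← numTriangulations_SC hk (by omega)]
    simp [tr, Nat.succ_le_iff.2 hk]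

/-! Signed counting by cut-off ears -/

/-- The entry `(i, j)` of the `l`-th power of the matrix `N` with `N i (i+1) = 1` and
`N i (i+2) = -1` unless `r ∣ i + 1`. -/
def earCoeff (r : ℕ) : ℕ → ℕ → ℕ → ℤ
  | 0, i, j => if i = j then 1 else 0
  | l + 1, i, j => earCoeff r l (i + 1) j - if r ∣ i + 1 then 0 else earCoeff r l (i + 2) j

theorem earCoeff_eq_zero {r l i j : ℕ} (h : j < i + l) : earCoeff r l i j = 0 := by
  induction l generalizing i with
  | zero => rw [earCoeff, if_neg (by omega)]
  | succ l ih => rw [earCoeff, ih (by omega), ih (by omega), ite_self, sub_zero]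

theorem earCoeff_add (r a b i j : ℕ) : earCoeff r (a + b) i j =
    ∑ m ∈ Finset.range (j + 1), earCoeff r a i m * earCoeff r b m j := by
  induction a generalizing i with
  | zero =>
    simp only [earCoeff, ite_mul, one_mul, zero_mul, Finset.sum_ite_eq, Finset.mem_range, zero_add]
    split_ifs with h
    · rfl
    · exact earCoeff_eq_zero (by omega)
  | succ a ih =>
    rw [Nat.add_right_comm, earCoeff, ih, ih]
    simp only [earCoeff, sub_mul, Finset.sum_sub_distrib]
    split_ifs <;> simp

/-- The entry `(i, j)` of `N C(N)`, with the Catalan series `C`. -/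
def earSum (r i j : ℕ) : ℤ :=
  ∑ l ∈ Finset.range (j + 1), (catalan l : ℤ) * earCoeff r (l + 1) i j

theorem earSum_eq_sum_range {r i j M : ℕ} (h : j + 1 ≤ M) : earSum r i j =
    ∑ l ∈ Finset.range M, (catalan l : ℤ) * earCoeff r (l + 1) i j := by
  refine Finset.sum_subset (Finset.range_mono h) fun l _ hl => ?_
  rw [Finset.mem_range] at hl
  rw [earCoeff_eq_zero (by omega), mul_zero]

theorem earSum_eq_zero {r i j : ℕ} (h : j ≤ i) : earSum r i j = 0 :=
  Finset.sum_eq_zero fun l _ => by rw [earCoeff_eq_zero (by omega), mul_zero]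

theorem sum_range_sum_range_eq_antidiagonal {M : Type*} [AddCommMonoid M] (n : ℕ)
    (f : ℕ → ℕ → M) (hf : ∀ a b, n ≤ a + b → f a b = 0) :
    ∑ a ∈ Finset.range n, ∑ b ∈ Finset.range n, f a b =
      ∑ l ∈ Finset.range n, ∑ p ∈ Finset.HasAntidiagonal.antidiagonal l, f p.1 p.2 := by
  rw [← Finset.sum_product', Finset.sum_sigma']
  symm
  refine Finset.sum_bij_ne_zero (fun x _ _ => x.2) ?_ ?_ ?_ ?_
  · rintro ⟨l, a, b⟩ h -
    simp only [Finset.mem_sigma, Finset.mem_range, Finset.HasAntidiagonal.mem_antidiagonal, Finset.mem_product]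
      at h ⊢
    omega
  · rintro ⟨l, a, b⟩ h - ⟨l', a', b'⟩ h' - heq
    simp only [Finset.mem_sigma, Finset.HasAntidiagonal.mem_antidiagonal] at h h'
    obtain ⟨rfl, rfl⟩ := Prod.mk.inj heq
    obtain rfl : l = l' := by omega
    rfl
  · rintro ⟨a, b⟩ h hne
    refine ⟨⟨a + b, a, b⟩, ?_, hne, rfl⟩
    simp only [Finset.mem_sigma, Finset.mem_range, Finset.HasAntidiagonal.mem_antidiagonal, and_true]
    by_contra hab
    exact hne (hf a b (by omega))
  · intros
    rfl

/-- The Catalan equation `C = 1 + N C²` turns `E = N C(N)` into `E = N + E²`. The sums are finite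
because `N` is strictly upper triangular. -/
theorem earSum_eq (r i j : ℕ) : earSum r i j =
    earCoeff r 1 i j + ∑ m ∈ Finset.Ioo i j, earSum r i m * earSum r m j := by
  have hsub : ∑ m ∈ Finset.Ioo i j, earSum r i m * earSum r m j =
      ∑ m ∈ Finset.range (j + 1), earSum r i m * earSum r m j := by
    refine Finset.sum_subset (fun m hm => ?_) fun m _ hm => ?_
    · rw [Finset.mem_Ioo] at hm
      rw [Finset.mem_range]
      omega
    · rw [Finset.mem_Ioo, not_and_or, not_lt, not_lt] at hm
      rcases hm with hm | hm
      · rw [earSum_eq_zero hm, zero_mul]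
      · rw [earSum_eq_zero hm, mul_zero]
  have hprod : ∑ m ∈ Finset.range (j + 1), earSum r i m * earSum r m j =
      ∑ a ∈ Finset.range (j + 1), ∑ b ∈ Finset.range (j + 1),
        (catalan a * catalan b : ℤ) * earCoeff r (a + b + 2) i j := by
    have : ∀ m ∈ Finset.range (j + 1), earSum r i m * earSum r m j =
        ∑ a ∈ Finset.range (j + 1), ∑ b ∈ Finset.range (j + 1), (catalan a * catalan b : ℤ) *
          (earCoeff r (a + 1) i m * earCoeff r (b + 1) m j) := by
      intro m hm
      rw [Finset.mem_range] at hm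
      rw [earSum_eq_sum_range (M := j + 1) (by omega), earSum, Finset.sum_mul_sum]
      exact Finset.sum_congr rfl fun a _ => Finset.sum_congr rfl fun b _ => by ring
    rw [Finset.sum_congr rfl this, Finset.sum_comm]
    refine Finset.sum_congr rfl fun a _ => ?_
    rw [Finset.sum_comm]
    refine Finset.sum_congr rfl fun b _ => ?_
    rw [← Finset.mul_sum, show a + b + 2 = a + 1 + (b + 1) by ring, earCoeff_add]
  rw [hsub, hprod, sum_range_sum_range_eq_antidiagonal]
  · rw [earSum_eq_sum_range (M := j + 2) (by omega), Finset.sum_range_succ', add_comm]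
    congr 1
    · simp
    · refine Finset.sum_congr rfl fun l _ => ?_
      rw [catalan_succ', Nat.cast_sum, Finset.sum_mul]
      refine Finset.sum_congr rfl fun p hp => ?_
      rw [Finset.HasAntidiagonal.mem_antidiagonal] at hp
      rw [hp]
      push_cast
      ring
  · intro a b h
    rw [earCoeff_eq_zero (by omega), mul_zero]

theorem earCoeff_one (r i j : ℕ) : earCoeff r 1 i j =
    (if i + 1 = j then 1 else 0) - if r ∣ i + 1 then 0 else if i + 2 = j then 1 else 0 := rfl

theorem earSum_succ (r i : ℕ) : earSum r i (i + 1) = 1 := by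
  rw [earSum_eq, earCoeff_one]
  have : Finset.Ioo i (i + 1) = ∅ := by ext; simp
  simp [this]

theorem sameSide_add_two_iff {r i : ℕ} (hr : 2 ≤ r) : SameSide r i (i + 2) ↔ ¬ r ∣ i + 1 := by
  constructor
  · rintro ⟨q, h₁, h₂⟩ ⟨m, hm⟩
    have l₁ : q < m := lt_of_mul_lt_mul_left (a := r) (by rw [← hm, mul_comm]; omega)
      (Nat.zero_le _)
    have l₂ : m < q + 1 := lt_of_mul_lt_mul_left (a := r) (by rw [← hm, mul_comm]; omega)
      (Nat.zero_le _)
    omega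
  · intro h
    have h₀ := Nat.div_add_mod i r
    have h₁ := Nat.mod_lt i (show r > 0 by omega)
    refine ⟨i / r, by rw [mul_comm]; omega, ?_⟩
    by_contra h₂
    rw [add_one_mul, mul_comm] at h₂
    exact h ⟨i / r + 1, by rw [mul_add_one]; omega⟩

/-- At length two the entry `-1` of `N` cancels the only splitting. At greater length each splitting
has a part of length at least two on the same side, which vanishes by induction. -/
theorem earSum_eq_zero_of_sameSide {r i j : ℕ} (hr : 2 ≤ r) (hij : i + 2 ≤ j)
    (h : SameSide r i j) : earSum r i j = 0 := by
  induction hn : j - i using Nat.strong_induction_on generalizing i j with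
  | _ n ih =>
    subst hn
    rw [earSum_eq, earCoeff_one, if_neg (by omega),
      if_neg ((sameSide_add_two_iff hr).1 (h.mono le_rfl hij))]
    rcases eq_or_lt_of_le hij with rfl | hij
    · have : Finset.Ioo i (i + 2) = {i + 1} := by ext; simp; omega
      rw [if_pos rfl, this, Finset.sum_singleton, earSum_succ, earSum_succ]
      norm_num
    · rw [if_neg (by omega), sub_zero, zero_add]
      refine Finset.sum_eq_zero fun m hm => ?_
      rw [Finset.mem_Ioo] at hm
      by_cases hm' : i + 2 ≤ m
      · rw [ih (m - i) (by omega) hm' (h.mono le_rfl hm.2.le) rfl, zero_mul]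
      · rw [ih (j - m) (by omega) (by omega) (h.mono hm.1.le le_rfl) rfl, mul_zero]

section

variable {k r : ℕ}

theorem earCoeff_one_of_not_badChord {i j : ℕ} (hr : 2 ≤ r) (hij : i + 2 ≤ j)
    (h : ¬ BadChord k r i j) : earCoeff r 1 i j = 0 := by
  rw [earCoeff_one, if_neg (by omega)]
  split_ifs with h₁ h₂
  · rfl
  · subst h₂
    exact (h ⟨le_rfl, .inl ((sameSide_add_two_iff hr).2 h₁)⟩).elim
  · rfl

/-- Both numbers vanish at bad chords and satisfy the same recurrence elsewhere. The excluded pairs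
are those for which 0 may act as the end of the last side. -/
theorem card_chordTriangs_eq_earSum {i j : ℕ} (hr : 2 ≤ r) (hij : i < j)
    (h : ¬ (i = 0 ∧ (k - 1) * r ≤ j)) :
    ((chordTriangs (fun a b => ¬ BadChord k r a b) i j).card : ℤ) = earSum r i j := by
  induction hn : j - i using Nat.strong_induction_on generalizing i j with
  | _ n ih =>
    subst hn
    rcases eq_or_lt_of_le (Nat.succ_le_of_lt hij) with rfl | hij'
    · rw [card_chordTriangs_succ, earSum_succ, Nat.cast_one]
      rintro ⟨h', -⟩
      omega
    by_cases hb : BadChord k r i j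
    · rw [card_chordTriangs_of_not (not_not.2 hb)]
      obtain ⟨h2, h' | h'⟩ := hb
      · rw [earSum_eq_zero_of_sameSide hr h2 h', Nat.cast_zero]
      · exact (h ⟨h'.1, h'.2.1⟩).elim
    · rw [card_chordTriangs hij' hb, earSum_eq, earCoeff_one_of_not_badChord hr hij' hb, zero_add,
        Nat.cast_sum]
      refine Finset.sum_congr rfl fun m hm => ?_
      rw [Finset.mem_Ioo] at hm
      rw [Nat.cast_mul, ih (m - i) (by omega) hm.1 (by omega) rfl,
        ih (j - m) (by omega) hm.2 (by omega) rfl]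

/-- Split the base `(0, kr - 1)` at `m`. The count and `earSum` can differ only for `m` on the last
side, where the factor of `(m, kr - 1)` vanishes unless `m = kr - 2`. At that `m` the chord `(0, m)`
is bad, but `earSum` does not know it. -/
theorem tr_eq_earSum_sub (hk : 2 ≤ k) (hr : 2 ≤ r) :
    tr k r = ((earSum r 0 (k * r - 1) - earSum r 0 (k * r - 2) : ℤ) : ℚ) := by
  have hn := Nat.mul_le_mul hk hr
  have hK := mul_eq_pred_mul_add (show 0 < k by omega) r
  have hK' : 1 * r ≤ (k - 1) * r := Nat.mul_le_mul_right r (by omega)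
  have hlast := sameSide_last (k := k) (r := r) (by omega)
  have hbase : ¬ BadChord k r 0 (k * r - 1) := by
    rintro ⟨h, h' | h'⟩
    · have := h'.le_of_zero (by omega)
      omega
    · omega
  rw [tr_eq_card hk hr, ← Int.cast_natCast]
  congr 1
  rw [card_chordTriangs (by omega) hbase, Nat.cast_sum, earSum_eq,
    earCoeff_one_of_not_badChord hr (by omega) hbase, zero_add]
  have hmem : k * r - 2 ∈ Finset.Ioo 0 (k * r - 1) := by
    rw [Finset.mem_Ioo]; omega
  rw [← Finset.add_sum_erase _ _ hmem, ← Finset.add_sum_erase _ _ hmem,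
    card_chordTriangs_of_not (i := 0) (j := k * r - 2)]
  · rw [show k * r - 1 = k * r - 2 + 1 by omega, earSum_succ, zero_mul, Nat.cast_zero, zero_add,
      mul_one, add_sub_cancel_left]
    refine Finset.sum_congr rfl fun m hm => ?_
    rw [Finset.mem_erase, Finset.mem_Ioo] at hm
    rw [Nat.cast_mul, card_chordTriangs_eq_earSum (i := m) hr (by omega) (by omega)]
    by_cases h : (k - 1) * r ≤ m
    · rw [earSum_eq_zero_of_sameSide hr (by omega) (hlast.mono h (by omega)), mul_zero, mul_zero]
    · rw [card_chordTriangs_eq_earSum hr (by omega) (by omega)]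
  · rw [not_not]
    exact ⟨by omega, .inr ⟨rfl, by omega, by omega⟩⟩

end

/-! The polynomials counting edges of a side after cutting off ears -/

/-- `u_r(z) = ∑ (-1)^j C(r-j, j) z^(r-j)`. -/
def earPoly : ℕ → ℤ[X]
  | 0 => 1
  | 1 => X
  | n + 2 => X * earPoly (n + 1) - X * earPoly n

/-- The generating polynomial of `earCoeff`. -/
def earGen (r i j : ℕ) : ℤ[X] := ∑ l ∈ Finset.range (j + 1), C (earCoeff r l i j) * X ^ l

theorem coeff_earGen (r i j l : ℕ) : (earGen r i j).coeff l = earCoeff r l i j := by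
  simp only [earGen, finsetSum_coeff, coeff_C_mul_X_pow, Finset.sum_ite_eq, Finset.mem_range]
  split_ifs with h
  · rfl
  · rw [earCoeff_eq_zero (by omega)]

theorem earGen_self (r j : ℕ) : earGen r j j = 1 := by
  ext l
  rw [coeff_earGen, coeff_one]
  cases l with
  | zero => simp [earCoeff]
  | succ l => rw [earCoeff_eq_zero (by omega), if_neg (by omega)]

theorem earGen_eq_zero {r i j : ℕ} (h : j < i) : earGen r i j = 0 := by
  ext l
  rw [coeff_earGen, earCoeff_eq_zero (by omega), coeff_zero]

/-- `earGen` is the entry of `(1 - X N)⁻¹`; this is row `i` of `(1 - X N) G = 1` off the diagonal.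
-/
theorem earGen_of_lt {r i j : ℕ} (h : i < j) : earGen r i j =
    X * earGen r (i + 1) j - if r ∣ i + 1 then 0 else X * earGen r (i + 2) j := by
  ext l
  cases l with
  | zero =>
    rw [coeff_earGen, earCoeff, if_neg (by omega)]
    split_ifs <;> simp
  | succ l =>
    rw [coeff_earGen, earCoeff]
    split_ifs <;> simp [coeff_earGen, coeff_X_mul]

/-- Moving the left end back along one side. -/
theorem earGen_sub {r a e j b : ℕ} (hae : a * r ≤ e) (her : e ≤ (a + 1) * r) (hej : e ≤ j)
    (he : e = (a + 1) * r ∨ e = j) (hb : a * r + b ≤ e) :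
    earGen r (e - b) j = earPoly b * earGen r e j := by
  induction b using Nat.strong_induction_on with
  | _ b ih =>
    match b with
    | 0 => simp [earPoly]
    | 1 =>
      rw [earGen_of_lt (by omega), show e - 1 + 1 = e by omega, earPoly]
      -- At a corner the two-step term is absent; at the right end `j` it vanishes because it jumps
      -- past `j`.
      rcases he with rfl | rfl
      · rw [if_pos (dvd_mul_left _ _), sub_zero]
      · rw [earGen_eq_zero (show e < e - 1 + 2 by omega), mul_zero, ite_self, sub_zero]
    | b + 2 =>
      rw [earGen_of_lt (by omega), if_neg, show e - (b + 2) + 1 = e - (b + 1) by omega,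
        show e - (b + 2) + 2 = e - b by omega, ih (b + 1) (by omega) (by omega),
        ih b (by omega) (by omega), earPoly]
      · ring
      -- The point `e - (b + 1)` lies strictly inside side `a`, so its label is no multiple of `r`.
      · rintro ⟨m, hm⟩
        have l₁ : a < m := lt_of_mul_lt_mul_left (a := r) (by rw [← hm, mul_comm]; omega)
          (Nat.zero_le _)
        have l₂ : m < a + 1 := lt_of_mul_lt_mul_left (a := r)
          (by rw [← hm, mul_comm r (a + 1)]; omega) (Nat.zero_le _)
        omega

/-- Moving back side by side, the piece at the right end contributes `u_b` and each full side `u_r`.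
-/
theorem earGen_zero (r a b : ℕ) (hb : b ≤ r) :
    earGen r 0 (a * r + b) = earPoly r ^ a * earPoly b := by
  have h : ∀ i ≤ a, earGen r ((a - i) * r) (a * r + b) = earPoly r ^ i * earPoly b := by
    intro i
    induction i with
    | zero =>
      intro _
      have := earGen_sub (r := r) (a := a) (e := a * r + b) (j := a * r + b) (b := b) (by omega)
        (by rw [add_one_mul]; omega) le_rfl (.inr rfl) le_rfl
      rw [earGen_self, mul_one, Nat.add_sub_cancel] at this
      simpa using this
    | succ i ih =>
      intro hi
      have hs : (a - (i + 1) + 1) * r = (a - i) * r := by congr 1; omega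
      have hle : (a - i) * r ≤ a * r := Nat.mul_le_mul_right r (by omega)
      have hs' := add_one_mul (a - (i + 1)) r
      have := earGen_sub (r := r) (a := a - (i + 1)) (e := (a - i) * r) (j := a * r + b) (b := r)
        (by omega) (by omega) (by omega) (.inl hs.symm) (by omega)
      rw [show (a - i) * r - r = (a - (i + 1)) * r by omega, ih (by omega)] at this
      rw [this]
      ring
  have := h a le_rfl
  rwa [Nat.sub_self, zero_mul] at this

/-! ### The linear functional counting polygon triangulations -/

/-- The weights `-1/2 [t^(n-1)] (1-2t)^2 / (1-t)^n`, that is, the numbers of triangulations of an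
`n`-gon extended by the value `-1/2` at `n = 1`. -/
def gonWeight : ℕ → ℚ
  | 0 => 0
  | 1 => -1 / 2
  | n + 2 => catalan n

/-- The linear functional taking `z^n` to `gonWeight n`. -/
def gonFunctional : ℤ[X] →+ ℚ where
  toFun p := p.sum fun n a => (a : ℚ) * gonWeight n
  map_zero' := by simp
  map_add' p q := sum_add_index p q _ (by simp) (by intros; push_cast; ring)

theorem gonFunctional_eq_sum {p : ℤ[X]} {M : ℕ} (h : p.natDegree < M) :
    gonFunctional p = ∑ n ∈ Finset.range M, (p.coeff n : ℚ) * gonWeight n :=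
  sum_over_range' (f := fun n (a : ℤ) => (a : ℚ) * gonWeight n) p (by simp) M h

/-- The factor `X` moves the power `l + 1` to `l + 2`, whose weight is `catalan l`. The weight
`-1/2` does not enter, as `earGen r 0 j` has no constant term. -/
theorem gonFunctional_X_mul_earGen {r j : ℕ} (hj : 0 < j) :
    gonFunctional (X * earGen r 0 j) = earSum r 0 j := by
  have hdeg : (X * earGen r 0 j).natDegree < j + 3 := by
    rw [Nat.lt_succ_iff, natDegree_le_iff_coeff_eq_zero]
    intro N hN
    obtain ⟨N, rfl⟩ : ∃ M, N = M + 1 := ⟨N - 1, by omega⟩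
    rw [coeff_X_mul, coeff_earGen, earCoeff_eq_zero (by omega)]
  rw [gonFunctional_eq_sum hdeg, Finset.sum_range_succ', Finset.sum_range_succ']
  simp only [gonWeight, coeff_X_mul, coeff_earGen, mul_zero, add_zero]
  rw [earCoeff, if_neg (by omega), earSum]
  push_cast
  simp [mul_comm]

/-- Both right ends lie on the last side, and `u_r = X u_{r-1} - X u_{r-2}` combines the two
products into `u_r^k`. -/
theorem gonFunctional_earPoly_pow {k r : ℕ} (hk : 1 ≤ k) (hr : 2 ≤ r) (h : 4 ≤ k * r) :
    gonFunctional (earPoly r ^ k) =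
      ((earSum r 0 (k * r - 1) - earSum r 0 (k * r - 2) : ℤ) : ℚ) := by
  obtain ⟨k, rfl⟩ : ∃ m, k = m + 1 := ⟨k - 1, by omega⟩
  obtain ⟨r, rfl⟩ : ∃ m, r = m + 2 := ⟨r - 2, by omega⟩
  rw [Int.cast_sub, ← gonFunctional_X_mul_earGen (by omega),
    ← gonFunctional_X_mul_earGen (by omega), ← map_sub]
  congr 1
  rw [show (k + 1) * (r + 2) - 1 = k * (r + 2) + (r + 1) by rw [add_one_mul]; omega,
    show (k + 1) * (r + 2) - 2 = k * (r + 2) + r by rw [add_one_mul]; omega,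
    earGen_zero _ _ _ (by omega), earGen_zero _ _ _ (by omega), pow_succ]
  nth_rw 2 [earPoly]
  ring

/-- `tr(k,r)` is obtained from `u_r(z)^k` by replacing `z^n` by the number of triangulations of
an `n`-gon. -/
theorem tr_eq_gonFunctional {k r : ℕ} (hr : 2 ≤ r) : tr k r = gonFunctional (earPoly r ^ k) := by
  -- For `k = 1` the values at `r = 2, 3` are computed from `u_2` and `u_3`; for `r ≥ 4` both ear
  -- sums belong to forbidden chords of the single side and vanish.
  rcases Nat.lt_or_ge k 2 with hk | hk
  · interval_cases k
    · rw [pow_zero, gonFunctional_eq_sum (M := 1) (by simp)]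
      simp [tr, gonWeight]
    · rcases Nat.lt_or_ge r 4 with hr' | hr'
      · rw [pow_one]
        interval_cases r
        · rw [show earPoly 2 = X ^ 2 - X by simp [earPoly]; ring,
            gonFunctional_eq_sum (M := 3) (by
              refine lt_of_le_of_lt (natDegree_sub_le _ _) ?_
              simp)]
          simp [tr, gonWeight, Finset.sum_range_succ, coeff_X, coeff_X_pow]
          norm_num
        · rw [show earPoly 3 = X ^ 3 - 2 * X ^ 2 by simp [earPoly]; ring,
            gonFunctional_eq_sum (M := 4) (by
              rw [Nat.lt_succ_iff]
              compute_degree)]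
          simp [tr, gonWeight, Finset.sum_range_succ, coeff_X_pow, coeff_ofNat_mul]
          norm_num
      · have hs : SameSide r 0 r := ⟨0, by omega, by omega⟩
        rw [gonFunctional_earPoly_pow le_rfl hr (by omega), one_mul,
          earSum_eq_zero_of_sameSide hr (by omega) (hs.mono le_rfl (by omega)),
          earSum_eq_zero_of_sameSide hr (by omega) (hs.mono le_rfl (by omega))]
        simp [tr, show r ≠ 2 by omega, show r ≠ 3 by omega]
  · rw [tr_eq_earSum_sub hk hr, gonFunctional_earPoly_pow (by omega) hr]
    exact Nat.mul_le_mul hk hr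

theorem earPoly_monic_natDegree (n : ℕ) : (earPoly n).Monic ∧ (earPoly n).natDegree = n := by
  induction n using Nat.twoStepInduction with
  | zero => simp [earPoly]
  | one => simp [earPoly, monic_X]
  | more n ih₁ ih₂ =>
    have h₁ : (X * earPoly (n + 1)).Monic := monic_X.mul ih₂.1
    have h₂ : (X * earPoly (n + 1)).natDegree = n + 2 := by
      rw [monic_X.natDegree_mul ih₂.1, natDegree_X, ih₂.2]; ring
    have h₃ : (X * earPoly n).natDegree = n + 1 := by
      rw [monic_X.natDegree_mul ih₁.1, natDegree_X, ih₁.2]; ring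
    have h : (X * earPoly n).degree < (X * earPoly (n + 1)).degree :=
      degree_lt_degree (by omega)
    rw [earPoly]
    exact ⟨h₁.sub_of_left h, by rw [natDegree_sub_eq_left_of_natDegree_lt (by omega), h₂]⟩

theorem earPoly_coeff_zero {n : ℕ} (hn : 0 < n) : (earPoly n).coeff 0 = 0 := by
  match n with
  | 1 => simp [earPoly]
  | n + 2 => simp [earPoly]

/-! ### The polynomial `P_r` in the variable `s = t(1-t)` -/

/-- `((1-t)^(n+1) - t^(n+1)) / (1-2t)` as a polynomial in `s = t(1-t)`. -/
def sidePoly : ℕ → ℤ[X]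
  | 0 => 1
  | 1 => 1
  | n + 2 => sidePoly (n + 1) - X * sidePoly n

theorem natDegree_sidePoly (n : ℕ) : 2 * (sidePoly n).natDegree ≤ n := by
  induction n using Nat.twoStepInduction with
  | zero => simp [sidePoly]
  | one => simp [sidePoly]
  | more n ih₁ ih₂ =>
    have h₁ := natDegree_sub_le (sidePoly (n + 1)) (X * sidePoly n)
    have h₂ := natDegree_mul_le (p := (X : ℤ[X])) (q := sidePoly n)
    rw [natDegree_X] at h₂
    rw [sidePoly]
    omega

/-- Both `t` and `1-t` are roots of `y² - y + s`, so their powers satisfy the recurrence that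
defines `sidePoly`. -/
theorem sidePoly_comp (n : ℕ) : (1 - 2 * X) * (sidePoly n).comp (X * (1 - X)) =
    ((1 - X) ^ (n + 1) - X ^ (n + 1) : ℤ[X]) := by
  induction n using Nat.twoStepInduction with
  | zero => simp [sidePoly]; ring
  | one => simp [sidePoly]; ring
  | more n ih₁ ih₂ =>
    rw [sidePoly, sub_comp, mul_comp, X_comp, mul_sub, ih₂, mul_left_comm, ih₁]
    ring

/-- Evaluation of an integer polynomial in a commutative ring. -/
def evalInt {R : Type*} [CommRing R] (s : R) : ℤ[X] →+* R := eval₂RingHom (Int.castRingHom R) s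

@[simp]
theorem evalInt_X {R : Type*} [CommRing R] (s : R) : evalInt s X = s := by
  simp [evalInt]

theorem evalInt_eq_sum_range {R : Type*} [CommRing R] (s : R) (p : ℤ[X]) :
    evalInt s p = ∑ j ∈ Finset.range (p.natDegree + 1), (p.coeff j : R) * s ^ j := by
  simp [evalInt, eval₂_eq_sum_range]

theorem map_evalInt {R S : Type*} [CommRing R] [CommRing S] (f : R →+* S) (s : R) (p : ℤ[X]) :
    f (evalInt s p) = evalInt (f s) p := by
  simp [evalInt_eq_sum_range]

section

variable {K : Type*} [Field K]

/-- The two families are reciprocal to each other, so nonzero roots of `rootPoly` are the solutions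
of `x u_r(1/s) = 1`. -/
theorem pow_mul_evalInt_earPoly_inv (n : ℕ) {s : K} (hs : s ≠ 0) :
    s ^ n * evalInt s⁻¹ (earPoly n) = evalInt s (sidePoly n) := by
  induction n using Nat.twoStepInduction with
  | zero => simp [sidePoly, earPoly]
  | one => simp [sidePoly, earPoly, hs]
  | more n ih₁ ih₂ =>
    rw [sidePoly, earPoly, map_sub, map_sub, map_mul, map_mul, map_mul, evalInt_X, evalInt_X, ← ih₁,
      ← ih₂]
    generalize evalInt s⁻¹ (earPoly n) = a
    generalize evalInt s⁻¹ (earPoly (n + 1)) = b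
    field_simp
    ring

/-- `P_r(x;t)` as a polynomial in `s = t(1-t)`. -/
def rootPoly (x : K) (r : ℕ) : K[X] :=
  X ^ r - C x * (sidePoly r).map (Int.castRingHom K)

theorem vertPoly_eq_comp (x : K) (r : ℕ) : vertPoly x r = (rootPoly x r).comp (X * (1 - X)) := by
  have h0 : (1 - 2 * X : K[X]) ≠ 0 := by
    intro h
    simpa using congrArg (eval 0) h
  have h := congrArg (map (Int.castRingHom K)) (sidePoly_comp r)
  simp only [Polynomial.map_mul, Polynomial.map_sub, Polynomial.map_pow, map_comp,
    Polynomial.map_one, map_X, Polynomial.map_ofNat] at h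
  rw [← vertPoly_div_exact] at h
  rw [vertPoly, ← mul_left_cancel₀ h0 h, rootPoly]
  simp [mul_pow]

theorem eval_vertPoly (x t : K) (r : ℕ) :
    (vertPoly x r).eval t = (rootPoly x r).eval (t * (1 - t)) := by
  simp [vertPoly_eq_comp]

theorem eval_derivative_vertPoly (x t : K) (r : ℕ) : (derivative (vertPoly x r)).eval t =
    (derivative (rootPoly x r)).eval (t * (1 - t)) * (1 - 2 * t) := by
  rw [vertPoly_eq_comp, derivative_comp]
  simp
  ring

theorem eval_rootPoly (x s : K) (r : ℕ) :
    (rootPoly x r).eval s = s ^ r - x * evalInt s (sidePoly r) := by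
  simp [rootPoly, evalInt, eval_map]

theorem degree_rootPoly_sub_lt (x : K) {r : ℕ} (hr : 0 < r) :
    (rootPoly x r - X ^ r).degree < (r : WithBot ℕ) := by
  rw [rootPoly, sub_sub_cancel_left, degree_neg]
  refine lt_of_le_of_lt degree_le_natDegree ?_
  have h₁ := natDegree_C_mul_le x ((sidePoly r).map (Int.castRingHom K))
  have h₂ := natDegree_map_le (f := Int.castRingHom K) (p := sidePoly r)
  have h₃ := natDegree_sidePoly r
  exact_mod_cast (by omega : (C x * (sidePoly r).map (Int.castRingHom K)).natDegree < r)

/-! ### Power sums of the roots and the coefficients of `1 / (1 - x u_r(z))` -/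

/-- A polynomial `s^r - x q(s)` with `r` distinct roots splits. -/
theorem rootPoly_eq_nodal {x : K} {r : ℕ} (hr : 0 < r) {s : Fin r → K}
    (hs : Function.Injective s) (h : ∀ i, (rootPoly x r).eval (s i) = 0) :
    rootPoly x r = Lagrange.nodal Finset.univ s := by
  refine Polynomial.eq_of_degree_sub_lt_of_eval_index_eq (s := Finset.univ) (v := s) hs.injOn ?_ ?_
  · rw [Finset.card_univ, Fintype.card_fin]
    have h₁ := degree_rootPoly_sub_lt x hr
    have h₂ : (X ^ r - Lagrange.nodal Finset.univ s).degree < (r : WithBot ℕ) := by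
      have hd : (Lagrange.nodal Finset.univ s).degree = r := by simp [Lagrange.degree_nodal]
      have := degree_sub_lt_left (p := X ^ r) (q := Lagrange.nodal Finset.univ s) (by rw [hd]; simp)
        (by simp) (by
          rw [(monic_X_pow r).leadingCoeff, Lagrange.nodal_monic.leadingCoeff])
      rwa [degree_X_pow] at this
    have := lt_of_le_of_lt (degree_add_le _ _) (max_lt h₁ h₂)
    rwa [sub_add_sub_cancel] at this
  · intro i _
    rw [h, Lagrange.eval_nodal_at_node (Finset.mem_univ i)]

/-- The power sums weighted by `1 / p'(s_i)` up to the exponent `r - 1`. -/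
theorem sum_pow_mul_nodalWeight {r m : ℕ} (hm : m < r) {s : Fin r → K}
    (hs : Function.Injective s) :
    ∑ i, s i ^ m * Lagrange.nodalWeight Finset.univ s i = if m + 1 = r then 1 else 0 := by
  -- The sum is the coefficient of degree `r - 1` in the Lagrange interpolant of `X^m`, which is
  -- `X^m` itself.
  have h := Lagrange.coeff_eq_sum (s := Finset.univ) (v := s) hs.injOn (P := X ^ m) (by
    rw [degree_X_pow]; simpa using hm)
  simp only [coeff_X_pow, Finset.card_univ, Fintype.card_fin, eval_pow, eval_X] at h
  simp only [Lagrange.nodalWeight, Finset.prod_inv_distrib, ← div_eq_mul_inv]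
  rw [← h]
  congr 1
  apply propext
  omega

/-- The coefficient of `z^m` in `1 / (1 - x u(z))`. -/
def geomCoeff (r m : ℕ) : PowerSeries ℚ :=
  PowerSeries.mk fun k => (((earPoly r ^ k).coeff m : ℤ) : ℚ)

theorem geomCoeff_zero {r : ℕ} (hr : 0 < r) : geomCoeff r 0 = 1 := by
  ext k
  rw [geomCoeff, PowerSeries.coeff_mk, PowerSeries.coeff_one]
  cases k with
  | zero => simp
  | succ k => rw [pow_succ, mul_coeff_zero, earPoly_coeff_zero hr]; simp

/-- Comparison of coefficients of `z^m` in `G = 1 + x u_r G` for `G = 1 / (1 - x u_r)`. -/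
theorem geomCoeff_succ {r m : ℕ} (hm : 0 < m) : geomCoeff r m =
    PowerSeries.X * ∑ i ∈ Finset.range (m + 1),
      ((((earPoly r).coeff i : ℤ) : ℚ) • geomCoeff r (m - i)) := by
  ext k
  cases k with
  | zero =>
    rw [geomCoeff, PowerSeries.coeff_mk, PowerSeries.coeff_zero_X_mul, pow_zero, coeff_one,
      if_neg (by omega), Int.cast_zero]
  | succ k =>
    rw [PowerSeries.coeff_succ_X_mul, map_sum, geomCoeff, PowerSeries.coeff_mk, pow_succ', coeff_mul,
      Finset.Nat.sum_antidiagonal_eq_sum_range_succ_mk, Int.cast_sum]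
    refine Finset.sum_congr rfl fun i _ => ?_
    rw [geomCoeff, PowerSeries.coeff_smul, PowerSeries.coeff_mk, smul_eq_mul, Int.cast_mul]

/-- The weighted power sums of the roots are the coefficients of `1 / (1 - x u(z))`. -/
theorem sum_pow_mul_nodalWeight_eq [CharZero K] {r : ℕ} (hr : 0 < r) (φ : PowerSeries ℚ →+* K)
    {s : Fin r → K} (hs : Function.Injective s) (hs0 : ∀ i, s i ≠ 0)
    (h : ∀ i, φ PowerSeries.X * evalInt (s i)⁻¹ (earPoly r) = 1) (m : ℕ) :
    ∑ i, s i ^ (m + r - 1) * Lagrange.nodalWeight Finset.univ s i = φ (geomCoeff r m) := by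
  induction m using Nat.strong_induction_on with
  | _ m ih =>
    rcases Nat.eq_zero_or_pos m with rfl | hm
    · rw [geomCoeff_zero hr, map_one, sum_pow_mul_nodalWeight (by omega) hs, if_pos (by omega)]
    -- Multiplying by `1 = x u_r(1/s_i)` lowers the exponents and gives the power sums the
    -- recurrence of `geomCoeff_succ`.
    have hpow : ∀ i, s i ^ (m + r - 1) = φ PowerSeries.X * ∑ j ∈ Finset.range (r + 1),
        (((earPoly r).coeff j : ℤ) : K) * s i ^ (m + r - 1 - j) := by
      intro i
      have e := congrArg (· * s i ^ (m + r - 1)) (h i)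
      simp only [one_mul] at e
      rw [← e, evalInt_eq_sum_range, (earPoly_monic_natDegree r).2, mul_assoc, Finset.sum_mul]
      congr 1
      refine Finset.sum_congr rfl fun j hj => ?_
      rw [Finset.mem_range] at hj
      rw [mul_assoc, pow_sub₀ (s i) (hs0 i) (show j ≤ m + r - 1 by omega), inv_pow, mul_comm (_ ^ _)⁻¹]
    have hsum : ∑ i, s i ^ (m + r - 1) * Lagrange.nodalWeight Finset.univ s i =
        φ PowerSeries.X * ∑ j ∈ Finset.range (r + 1), (((earPoly r).coeff j : ℤ) : K) *
          ∑ i, s i ^ (m + r - 1 - j) * Lagrange.nodalWeight Finset.univ s i := by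
      simp_rw [hpow, Finset.mul_sum, Finset.sum_mul]
      rw [Finset.sum_comm]
      refine Finset.sum_congr rfl fun j _ => ?_
      refine Finset.sum_congr rfl fun i _ => ?_
      ring
    have hcast : ∀ (a : ℤ) (f : PowerSeries ℚ), φ ((a : ℚ) • f) = (a : K) * φ f := by
      intro a f
      rw [PowerSeries.smul_eq_C_mul, map_mul]
      simp
    rw [hsum, geomCoeff_succ hm, map_mul, map_sum]
    congr 1
    -- For `j > m` the exponent is below `r - 1` and the power sum vanishes. The term `j = 0`, out
    -- of reach of the induction, has coefficient zero.
    have e₁ : ∀ j ∈ Finset.range (r + 1), (((earPoly r).coeff j : ℤ) : K) *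
          ∑ i, s i ^ (m + r - 1 - j) * Lagrange.nodalWeight Finset.univ s i =
        if j ≤ m then (((earPoly r).coeff j : ℤ) : K) * φ (geomCoeff r (m - j)) else 0 := by
      intro j hj
      rw [Finset.mem_range] at hj
      rcases Nat.eq_zero_or_pos j with rfl | hj0
      · simp [earPoly_coeff_zero hr]
      split_ifs with hjm
      · rw [← ih (m - j) (by omega), show m - j + r - 1 = m + r - 1 - j by omega]
      · rw [sum_pow_mul_nodalWeight (by omega) hs, if_neg (by omega), mul_zero]
    have e₂ : ∀ j ∈ Finset.range (m + 1),
        φ ((((earPoly r).coeff j : ℤ) : ℚ) • geomCoeff r (m - j)) =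
        if j ≤ m then (((earPoly r).coeff j : ℤ) : K) * φ (geomCoeff r (m - j)) else 0 := by
      intro j hj
      rw [Finset.mem_range] at hj
      rw [if_pos (by omega), hcast]
    rw [Finset.sum_congr rfl e₁, Finset.sum_congr rfl e₂]
    rw [Finset.sum_subset (Finset.range_mono (show r + 1 ≤ m + r + 1 by omega)),
      Finset.sum_subset (Finset.range_mono (show m + 1 ≤ m + r + 1 by omega))]
    · intro j _ hj
      rw [Finset.mem_range] at hj
      rw [if_neg (by omega)]
    · intro j _ hj
      rw [Finset.mem_range, not_lt] at hj
      rw [coeff_eq_zero_of_natDegree_lt (by rw [(earPoly_monic_natDegree r).2]; omega)]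
      simp

end

/-! ### Truncated Catalan series -/

/-- The truncation of `s C(s)`, the power series inverse of `s = t - t^2`. -/
def catalanPoly (M : ℕ) : ℤ[X] := ∑ m ∈ Finset.range M, (catalan m : ℤ[X]) * X ^ (m + 1)

/-- The full series `c = X C` satisfies `c² - c + X = 0`, and the truncation agrees with it modulo
`X^(M+1)`. -/
theorem exists_catalanPoly_eq (M : ℕ) : ∃ g : ℤ[X],
    catalanPoly M ^ 2 - catalanPoly M + X = X ^ (M + 1) * g := by
  have hC : (PowerSeries.map (Nat.castRingHom ℤ) PowerSeries.catalanSeries) ^ 2 * PowerSeries.X + 1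
      = PowerSeries.map (Nat.castRingHom ℤ) PowerSeries.catalanSeries := by
    conv_rhs => rw [← PowerSeries.catalanSeries_sq_mul_X_add_one]
    simp
  set c := PowerSeries.map (Nat.castRingHom ℤ) PowerSeries.catalanSeries with hc
  have hT : PowerSeries.X ^ (M + 1) ∣ PowerSeries.X * c - (catalanPoly M : PowerSeries ℤ) := by
    rw [PowerSeries.X_pow_dvd_iff]
    intro l hl
    rw [map_sub, coeff_coe]
    cases l with
    | zero => simp [catalanPoly, finsetSum_coeff]
    | succ l =>
      rw [PowerSeries.coeff_succ_X_mul, hc, PowerSeries.coeff_map,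
        PowerSeries.catalanSeries_coeff, catalanPoly, finsetSum_coeff]
      have : ∀ m ∈ Finset.range M, ((catalan m : ℤ[X]) * X ^ (m + 1)).coeff (l + 1) =
          if m = l then (catalan m : ℤ) else 0 := by
        intro m _
        rw [← C_eq_natCast, coeff_C_mul_X_pow]
        simp [eq_comm]
      rw [Finset.sum_congr rfl this, Finset.sum_ite_eq', if_pos (Finset.mem_range.2 (by omega))]
      simp
  obtain ⟨d, hd⟩ := hT
  have hdvd : (PowerSeries.X : PowerSeries ℤ) ^ (M + 1) ∣
      ((catalanPoly M ^ 2 - catalanPoly M + X : ℤ[X]) : PowerSeries ℤ) := by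
    refine ⟨d * (1 - PowerSeries.X * c - (catalanPoly M : PowerSeries ℤ)), ?_⟩
    push_cast
    linear_combination (1 - PowerSeries.X * c - (catalanPoly M : PowerSeries ℤ)) * hd +
      PowerSeries.X * hC
  rw [PowerSeries.X_pow_dvd_iff] at hdvd
  exact X_pow_dvd_iff.2 fun l hl => by rw [← coeff_coe]; exact hdvd l hl

/-! Roots in power series and Puiseux series -/

theorem PowerSeries.smodEq_iff_X_pow_dvd {F : Type*} [CommRing F] {n : ℕ} {f g : PowerSeries F} :
    f ≡ g [SMOD (Ideal.span {(PowerSeries.X : PowerSeries F)} ^ n • ⊤ :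
      Submodule (PowerSeries F) (PowerSeries F))] ↔ PowerSeries.X ^ n ∣ f - g := by
  rw [SModEq.sub_mem, smul_eq_mul, Ideal.mul_top, Ideal.span_singleton_pow,
    Ideal.mem_span_singleton]

/-- Supplies the completeness for Hensel's lemma: the limit takes its `n`-th coefficient from the
`(n+1)`-st term. -/
theorem PowerSeries.isAdicComplete_span_X (F : Type*) [CommRing F] :
    IsAdicComplete (Ideal.span {(PowerSeries.X : PowerSeries F)}) (PowerSeries F) where
  haus' f h := by
    ext n
    have := h (n + 1)
    rw [PowerSeries.smodEq_iff_X_pow_dvd, sub_zero, PowerSeries.X_pow_dvd_iff] at this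
    simpa using this n (Nat.lt_succ_self n)
  prec' f h := by
    refine ⟨PowerSeries.mk fun n => PowerSeries.coeff n (f (n + 1)), fun n => ?_⟩
    rw [PowerSeries.smodEq_iff_X_pow_dvd, PowerSeries.X_pow_dvd_iff]
    intro m hm
    have := h (show m + 1 ≤ n from hm)
    rw [PowerSeries.smodEq_iff_X_pow_dvd, PowerSeries.X_pow_dvd_iff] at this
    have := this m (Nat.lt_succ_self m)
    rw [map_sub, sub_eq_zero] at this
    rw [map_sub, PowerSeries.coeff_mk, this, sub_self]

/-- Hensel's lemma for power series over a field. -/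
theorem PowerSeries.exists_root_of_constantCoeff {F : Type*} [Field F] {p : (PowerSeries F)[X]}
    (hp : p.Monic) {a : F} (h₀ : PowerSeries.constantCoeff (p.eval (PowerSeries.C a)) = 0)
    (h₁ : PowerSeries.constantCoeff ((Polynomial.derivative p).eval (PowerSeries.C a)) ≠ 0) :
    ∃ f : PowerSeries F, p.eval f = 0 ∧ PowerSeries.constantCoeff f = a := by
  have := PowerSeries.isAdicComplete_span_X F
  obtain ⟨f, hf, hfa⟩ := HenselianRing.is_henselian (I := Ideal.span {(PowerSeries.X :
      PowerSeries F)}) p hp (PowerSeries.C a)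
    (by rwa [Ideal.mem_span_singleton, PowerSeries.X_dvd_iff])
    ((PowerSeries.isUnit_iff_constantCoeff.2 (isUnit_iff_ne_zero.2 h₁)).map _)
  refine ⟨f, hf, ?_⟩
  rw [Ideal.mem_span_singleton, PowerSeries.X_dvd_iff, map_sub, sub_eq_zero] at hfa
  simpa using hfa

/-- The roots `s = Y / v` of `Y^r u_r(1/s) = 1`, in the form `s = T (1 - T)`. -/
theorem exists_puiseux_root {r : ℕ} (hr : 0 < r) {ζ : ℂ} (hζ : ζ ^ r = 1) :
    ∃ v T : PowerSeries ℂ, PowerSeries.constantCoeff v = ζ ∧ PowerSeries.constantCoeff T = 0 ∧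
      T * (1 - T) * v = PowerSeries.X ∧
      ∑ j ∈ Finset.range (r + 1),
        (((earPoly r).coeff j : ℤ) : PowerSeries ℂ) * PowerSeries.X ^ (r - j) * v ^ j = 1 := by
  have hζ0 : ζ ≠ 0 := by
    rintro rfl
    simp [hr.ne'] at hζ
  obtain ⟨hmon, hdeg⟩ := earPoly_monic_natDegree r
  -- With `s = Y / v` the equation reads `Y^r u_r(v / Y) = 1`, and the left side is `scaleRoots` of
  -- `u_r` by `Y`, evaluated at `v`. Modulo `Y` it becomes `v^r = 1`, with the simple root `ζ`.
  set U := (earPoly r).map (Int.castRingHom (PowerSeries ℂ)) with hU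
  have hUdeg : U.natDegree = r := by rw [hU, hmon.natDegree_map, hdeg]
  have hUmon : (scaleRoots U PowerSeries.X).Monic :=
    (monic_scaleRoots_iff _).2 (hmon.map _)
  have hSdeg : (scaleRoots U PowerSeries.X).natDegree = r := by rw [natDegree_scaleRoots, hUdeg]
  have hp : (scaleRoots U PowerSeries.X - 1).Monic := by
    refine hUmon.sub_of_left (lt_of_le_of_lt degree_one_le ?_)
    rw [← natDegree_pos_iff_degree_pos, hSdeg]
    exact hr
  have hmap : (scaleRoots U PowerSeries.X - 1).map PowerSeries.constantCoeff = X ^ r - 1 := by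
    rw [Polynomial.map_sub, Polynomial.map_one]
    congr 1
    ext j
    rw [coeff_map, coeff_scaleRoots, hUdeg, coeff_X_pow, map_mul, map_pow,
      PowerSeries.constantCoeff_X, hU, coeff_map]
    split_ifs with hj
    · subst hj
      have := hmon.coeff_natDegree
      rw [hdeg] at this
      simp [this]
    · rcases lt_or_gt_of_ne hj with hj | hj
      · rw [zero_pow (by omega), mul_zero]
      · rw [coeff_eq_zero_of_natDegree_lt (by omega)]
        simp
  have heval : ∀ q : (PowerSeries ℂ)[X], PowerSeries.constantCoeff (q.eval (PowerSeries.C ζ)) =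
      (q.map PowerSeries.constantCoeff).eval ζ := by
    intro q
    rw [← eval_map_apply, PowerSeries.constantCoeff_C]
  obtain ⟨v, hv, hvζ⟩ := PowerSeries.exists_root_of_constantCoeff hp (a := ζ)
    (by rw [heval, hmap]; simp [hζ])
    (by
      rw [heval, ← derivative_map, hmap]
      have : (r : ℂ) ≠ 0 := by exact_mod_cast hr.ne'
      rw [derivative_sub, derivative_one, sub_zero, derivative_X_pow]
      simp [hζ0, this])
  have hv0 : PowerSeries.constantCoeff v ≠ 0 := by rwa [hvζ]
  -- Hensel's lemma again, for `T² - T + Y / v`, whose reduction `T² - T` has the simple root 0.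
  have hq : (X ^ 2 - X + C (PowerSeries.X * v⁻¹) : (PowerSeries ℂ)[X]).Monic := by
    rw [sub_add]
    refine (monic_X_pow 2).sub_of_left ?_
    rw [degree_X_pow]
    refine lt_of_le_of_lt (degree_sub_le _ _) (max_lt ?_ ?_)
    · rw [degree_X]; norm_num
    · exact lt_of_le_of_lt degree_C_le (by norm_num)
  obtain ⟨T, hT, hT0⟩ := PowerSeries.exists_root_of_constantCoeff hq (a := 0) (by simp) (by simp)
  refine ⟨v, T, hvζ, hT0, ?_, ?_⟩
  · have hvv := PowerSeries.mul_inv_cancel v hv0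
    simp only [eval_add, eval_sub, eval_pow, eval_X, eval_C] at hT
    linear_combination -v * hT + PowerSeries.X * hvv
  · rw [eval_sub, eval_one, sub_eq_zero, eval_eq_sum_range, hSdeg] at hv
    rw [← hv]
    refine Finset.sum_congr rfl fun j _ => ?_
    rw [coeff_scaleRoots, hUdeg, hU, coeff_map]
    simp

/-! ### Power series inside Puiseux series, and divisibility by powers of `x` -/

/-- The embedding of power series in `Y` into Puiseux series, `Y = x^(1/r)`. -/
def puiseuxHom (r : ℕ) (hr : 0 < r) : PowerSeries ℂ →+* HahnSeries ℚ ℂ :=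
  (HahnSeries.embDomainRingHom
    ((AddMonoidHom.mulRight ((r : ℚ)⁻¹)).comp (Nat.castAddMonoidHom ℚ))
    (fun a b h => by
      have : (r : ℚ) ≠ 0 := by exact_mod_cast hr.ne'
      simpa [this] using h)
    (fun a b => by
      have : 0 < (r : ℚ)⁻¹ := by positivity
      simp [this])).comp
    (HahnSeries.toPowerSeries (R := ℂ)).symm.toRingHom

section

variable {r : ℕ} {hr : 0 < r}

theorem puiseuxHom_injective : Function.Injective (puiseuxHom r hr) :=
  HahnSeries.embDomain_injective.comp HahnSeries.toPowerSeries.symm.injective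

theorem mem_support_puiseuxHom {f : PowerSeries ℂ} {q : ℚ}
    (h : q ∈ (puiseuxHom r hr f).support) : ∃ n : ℕ, q = n / r := by
  obtain ⟨n, -, rfl⟩ := HahnSeries.support_embDomain_subset h
  exact ⟨n, by simp [div_eq_mul_inv]⟩

theorem puiseuxHom_X : puiseuxHom r hr PowerSeries.X = HahnSeries.single (r : ℚ)⁻¹ 1 := by
  have : HahnSeries.toPowerSeries.symm (PowerSeries.X : PowerSeries ℂ) =
      HahnSeries.single 1 1 := by
    ext n
    rw [HahnSeries.coeff_toPowerSeries_symm, PowerSeries.coeff_X, HahnSeries.coeff_single]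
    congr
  simp only [puiseuxHom, RingHom.coe_comp, Function.comp_apply]
  change HahnSeries.embDomain _ (HahnSeries.toPowerSeries.symm (PowerSeries.X : PowerSeries ℂ)) = _
  rw [this, HahnSeries.embDomain_single]
  simp

theorem puiseuxHom_X_pow : puiseuxHom r hr PowerSeries.X ^ r = puiseuxX := by
  have : (r : ℚ) ≠ 0 := by exact_mod_cast hr.ne'
  rw [puiseuxHom_X, HahnSeries.single_pow, puiseuxX]
  simp [this]

theorem isPuiseux_puiseuxHom (f : PowerSeries ℂ) : IsPuiseux (puiseuxHom r hr f) := by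
  refine ⟨r, hr, fun q hq => ?_⟩
  obtain ⟨n, rfl⟩ := mem_support_puiseuxHom hq
  exact ⟨n, by simp⟩

theorem orderTop_puiseuxHom_nonneg (f : PowerSeries ℂ) : 0 ≤ (puiseuxHom r hr f).orderTop := by
  by_cases h : puiseuxHom r hr f = 0
  · rw [h, HahnSeries.orderTop_zero]
    exact le_top
  · obtain ⟨n, hn⟩ := mem_support_puiseuxHom (HahnSeries.coeff_order_eq_zero.not.2 h)
    rw [← HahnSeries.order_eq_orderTop_of_ne_zero h, hn]
    exact_mod_cast (by positivity : (0 : ℚ) ≤ n / r)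

theorem orderTop_puiseuxHom_pos {f : PowerSeries ℂ} (hf : PowerSeries.constantCoeff f = 0) :
    0 < (puiseuxHom r hr f).orderTop := by
  obtain ⟨g, rfl⟩ := PowerSeries.X_dvd_iff.2 hf
  rw [map_mul, HahnSeries.orderTop_mul, puiseuxHom_X, HahnSeries.orderTop_single one_ne_zero]
  have h : (0 : WithTop ℚ) < ((r : ℚ)⁻¹ : ℚ) := by
    exact_mod_cast (by positivity : (0 : ℚ) < (r : ℚ)⁻¹)
  exact add_pos_of_pos_of_nonneg h (orderTop_puiseuxHom_nonneg g)

end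

/-- The Hahn series without negative exponents. -/
def integralSeries : Subring (HahnSeries ℚ ℂ) where
  carrier := {f | 0 ≤ f.orderTop}
  mul_mem' {f g} hf hg := by
    rw [Set.mem_ofPred_eq] at *
    rw [HahnSeries.orderTop_mul]
    exact add_nonneg hf hg
  one_mem' := by simp [HahnSeries.orderTop_one]
  add_mem' {f g} hf hg := by
    rw [Set.mem_ofPred_eq] at *
    exact (le_min hf hg).trans HahnSeries.min_orderTop_le_orderTop_add
  zero_mem' := by simp
  neg_mem' {f} hf := by simpa using hf

theorem mem_integralSeries {f : HahnSeries ℚ ℂ} : f ∈ integralSeries ↔ 0 ≤ f.orderTop :=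
  Iff.rfl

theorem orderTop_puiseuxX_pow (n : ℕ) : (puiseuxX ^ n).orderTop = (n : ℚ) := by
  rw [puiseuxX, HahnSeries.single_pow, one_pow, HahnSeries.orderTop_single one_ne_zero]
  simp

theorem puiseuxX_ne_zero : puiseuxX ≠ 0 := HahnSeries.single_ne_zero one_ne_zero

theorem exists_pow_mul_mem_integralSeries (f : HahnSeries ℚ ℂ) :
    ∃ n : ℕ, puiseuxX ^ n * f ∈ integralSeries := by
  by_cases hf : f = 0
  · exact ⟨0, by simp [hf]⟩
  obtain ⟨n, hn⟩ := exists_nat_ge (-f.order)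
  refine ⟨n, ?_⟩
  rw [mem_integralSeries, HahnSeries.orderTop_mul, orderTop_puiseuxX_pow, ← HahnSeries.order_eq_orderTop_of_ne_zero hf]
  exact_mod_cast (by linarith : 0 ≤ (n : ℚ) + f.order)

/-- The `x`-adic topology on the integral series is separated; this replaces convergence arguments
for infinite sums. -/
theorem eq_zero_of_forall_pow_dvd {f : HahnSeries ℚ ℂ}
    (h : ∀ n : ℕ, ∃ g ∈ integralSeries, f = puiseuxX ^ n * g) : f = 0 := by
  by_contra hf
  obtain ⟨n, hn⟩ := exists_nat_gt f.order
  obtain ⟨g, hg, rfl⟩ := h n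
  rw [mem_integralSeries] at hg
  have : (n : WithTop ℚ) ≤ (puiseuxX ^ n * g).orderTop := by
    rw [HahnSeries.orderTop_mul, orderTop_puiseuxX_pow]
    exact le_add_of_nonneg_right hg
  rw [← HahnSeries.order_eq_orderTop_of_ne_zero hf] at this
  exact absurd hn (not_lt.2 (by exact_mod_cast this))

/-- `toPuiseux` as a ring homomorphism. -/
def toPuiseuxHom : PowerSeries ℚ →+* HahnSeries ℚ ℂ :=
  (HahnSeries.ofPowerSeries ℚ ℂ).comp (PowerSeries.map (algebraMap ℚ ℂ))

theorem toPuiseuxHom_apply (f : PowerSeries ℚ) : toPuiseuxHom f = toPuiseux f := by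
  simp only [toPuiseuxHom, toPuiseux, RingHom.comp_apply]

theorem toPuiseuxHom_injective : Function.Injective toPuiseuxHom := by
  have h₁ : Function.Injective (PowerSeries.map (algebraMap ℚ ℂ)) :=
    PowerSeries.map_injective _ (algebraMap ℚ ℂ).injective
  have h₂ : Function.Injective (HahnSeries.ofPowerSeries ℚ ℂ) :=
    HahnSeries.ofPowerSeries_injective
  rw [toPuiseuxHom, RingHom.coe_comp]
  exact h₂.comp h₁

instance : CharZero (HahnSeries ℚ ℂ) :=
  charZero_of_injective_ringHom (HahnSeries.C_injective (Γ := ℚ) (R := ℂ))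

theorem toPuiseuxHom_X : toPuiseuxHom PowerSeries.X = puiseuxX := by
  simp [toPuiseuxHom, puiseuxX]

theorem toPuiseuxHom_smul (q : ℚ) (f : PowerSeries ℚ) :
    toPuiseuxHom (q • f) = (q : HahnSeries ℚ ℂ) * toPuiseuxHom f := by
  rw [PowerSeries.smul_eq_C_mul, map_mul]
  congr 1
  exact eq_ratCast (toPuiseuxHom.comp PowerSeries.C) q

theorem toPuiseuxHom_mem_integralSeries (f : PowerSeries ℚ) :
    toPuiseuxHom f ∈ integralSeries := by
  rw [mem_integralSeries, HahnSeries.le_orderTop_iff_forall]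
  intro q hq
  by_contra h
  obtain ⟨n, -, rfl⟩ := HahnSeries.support_embDomain_subset (HahnSeries.mem_support _ _ |>.2 h)
  have : ((n : ℚ) : WithTop ℚ) < 0 := hq
  exact absurd (show (n : ℚ) < 0 by exact_mod_cast this) (not_lt.2 (Nat.cast_nonneg n))

/-- With `S = T(1-T)` and the truncation `c` at `S`, the quadratic equation factors as `(T - c)(1 -
T - c) = S^(M+1) g`. The second factor on the left is a unit and `S` is a multiple of `X`. -/
theorem exists_catalan_approx {v T : PowerSeries ℂ} (hT : PowerSeries.constantCoeff T = 0)
    (hv : PowerSeries.constantCoeff v ≠ 0) (hTv : T * (1 - T) * v = PowerSeries.X) (M : ℕ) :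
    ∃ h, T = evalInt (T * (1 - T)) (catalanPoly M) + PowerSeries.X ^ M * h := by
  obtain ⟨g, hg⟩ := exists_catalanPoly_eq M
  have hg' := congrArg (evalInt (T * (1 - T))) hg
  simp only [map_add, map_sub, map_mul, map_pow, evalInt_X] at hg'
  set c := evalInt (T * (1 - T)) (catalanPoly M) with hc
  have hc0 : PowerSeries.constantCoeff c = 0 := by
    rw [hc, catalanPoly, map_sum, map_sum]
    refine Finset.sum_eq_zero fun m _ => ?_
    simp [hT]
  have hb := PowerSeries.mul_inv_cancel (1 - T - c) (by simp [hT, hc0])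
  have hvv := PowerSeries.mul_inv_cancel v hv
  have hS : T * (1 - T) = PowerSeries.X * v⁻¹ := by
    linear_combination v⁻¹ * hTv - T * (1 - T) * hvv
  refine ⟨v⁻¹ ^ M * (T * (1 - T)) * evalInt (T * (1 - T)) g * (1 - T - c)⁻¹, ?_⟩
  have hpow : (T * (1 - T)) ^ (M + 1) = PowerSeries.X ^ M * v⁻¹ ^ M * (T * (1 - T)) := by
    rw [pow_succ, ← mul_pow, ← hS]
  rw [hpow] at hg'
  linear_combination (1 - T - c)⁻¹ * hg' - (T - c) * hb

/-- The weights are the coefficients of `-(1/2) √(1-4s)`; the value `-1/2` at index 1 supplies the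
constant term. -/
theorem one_sub_two_mul_catalanPoly {K : Type*} [Field K] [CharZero K] (s : K) (M : ℕ) :
    1 - 2 * evalInt s (catalanPoly M) =
      -2 * ∑ n ∈ Finset.range (M + 1), (gonWeight (n + 1) : K) * s ^ n := by
  rw [Finset.sum_range_succ', catalanPoly, map_sum]
  simp only [gonWeight, map_mul, map_pow, map_natCast, evalInt_X, pow_zero]
  push_cast
  ring

/-- As `u_r^k` has degree `rk`, the coefficients of `x^k` with `k < N` involve only the weights in
the finite sum. -/
theorem exists_verticalGF_approx {r : ℕ} (hr : 2 ≤ r) (N : ℕ) : ∃ h, verticalGF r =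
    ∑ n ∈ Finset.range (r * N + 1), gonWeight (n + 1) • geomCoeff r (n + 1) +
      PowerSeries.X ^ N * h := by
  suffices H : PowerSeries.X ^ N ∣ verticalGF r -
      ∑ n ∈ Finset.range (r * N + 1), gonWeight (n + 1) • geomCoeff r (n + 1) by
    obtain ⟨h, hh⟩ := H
    exact ⟨h, by rw [← hh]; ring⟩
  rw [PowerSeries.X_pow_dvd_iff]
  intro k hk
  rw [map_sub, sub_eq_zero, verticalGF, PowerSeries.coeff_mk, tr_eq_gonFunctional hr,
    gonFunctional_eq_sum (M := r * N + 2), Finset.sum_range_succ', map_sum]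
  · simp only [gonWeight, mul_zero, add_zero]
    refine Finset.sum_congr rfl fun n _ => ?_
    rw [PowerSeries.coeff_smul, geomCoeff, PowerSeries.coeff_mk, smul_eq_mul, mul_comm]
  · rw [(earPoly_monic_natDegree r).1.natDegree_pow, (earPoly_monic_natDegree r).2, mul_comm]
    have := Nat.mul_le_mul_left r hk.le
    omega

/-- The `r` small roots `T_i`, as power series in `x^(1/r)`. -/
theorem exists_smallRoots {r : ℕ} (hr : 0 < r) : ∃ v T : Fin r → PowerSeries ℂ,
    (∀ i, PowerSeries.constantCoeff (v i) ≠ 0) ∧ (∀ i, PowerSeries.constantCoeff (T i) = 0) ∧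
    (∀ i, T i * (1 - T i) * v i = PowerSeries.X) ∧
    Function.Injective (fun i => puiseuxHom r hr (T i * (1 - T i))) ∧
    ∀ i, puiseuxX * evalInt (puiseuxHom r hr (T i * (1 - T i)))⁻¹ (earPoly r) = 1 := by
  have hζ := Complex.isPrimitiveRoot_exp r hr.ne'
  set ζ := Complex.exp (2 * Real.pi * Complex.I / r)
  have h1 : ∀ i : ℕ, (ζ ^ i) ^ r = 1 := fun i => by rw [pow_right_comm, hζ.pow_eq_one, one_pow]
  choose v T hv hT hTv hsum using fun i : Fin r => exists_puiseux_root hr (h1 i)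
  have hv0 : ∀ i, PowerSeries.constantCoeff (v i) ≠ 0 := fun i => by
    rw [hv]
    exact pow_ne_zero _ (hζ.ne_zero hr.ne')
  refine ⟨v, T, hv0, hT, hTv, ?_, ?_⟩
  · intro i j hij
    have e := puiseuxHom_injective hij
    have h0 : T i * (1 - T i) ≠ 0 := fun h0 => by
      have := hTv i
      rw [h0, zero_mul] at this
      exact PowerSeries.X_ne_zero this.symm
    have hvv : v i = v j := by
      apply mul_left_cancel₀ h0
      rw [hTv, e, hTv]
    have := congrArg PowerSeries.constantCoeff hvv
    rw [hv, hv] at this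
    exact Fin.ext (hζ.pow_inj i.2 j.2 this)
  · intro i
    have hy : puiseuxHom r hr PowerSeries.X ≠ 0 := by
      rw [Ne, map_eq_zero_iff _ puiseuxHom_injective]
      exact PowerSeries.X_ne_zero
    have hs := congrArg (puiseuxHom r hr) (hTv i)
    rw [map_mul] at hs
    have hinv : (puiseuxHom r hr (T i * (1 - T i)))⁻¹ =
        puiseuxHom r hr (v i) * (puiseuxHom r hr PowerSeries.X)⁻¹ := by
      rw [eq_mul_inv_iff_mul_eq₀ hy, ← hs, inv_mul_cancel_left₀]
      intro h0
      rw [h0, zero_mul] at hs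
      exact hy hs.symm
    have h := congrArg (puiseuxHom r hr) (hsum i)
    rw [map_one, map_sum] at h
    rw [hinv, evalInt_eq_sum_range, (earPoly_monic_natDegree r).2, ← puiseuxHom_X_pow (hr := hr), ← h,
      Finset.mul_sum]
    refine Finset.sum_congr rfl fun j hj => ?_
    rw [Finset.mem_range] at hj
    rw [map_mul, map_mul, map_pow, map_pow, map_intCast,
      pow_sub₀ _ hy (by omega), mul_pow, inv_pow]
    ring

/-! ### The generating function as a sum over the roots -/

section

variable {r : ℕ} {hr : 0 < r} {v T : Fin r → PowerSeries ℂ}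

/-- Truncating the weights on the left and the Catalan expansion of each root on the right leaves
the same finite sum, because the power sums weighted by `κ` are the `geomCoeff`. The errors are
multiples of `x^N`, up to a fixed denominator. -/
theorem toPuiseux_verticalGF_eq (hr2 : 2 ≤ r)
    (hv : ∀ i, PowerSeries.constantCoeff (v i) ≠ 0)
    (hT : ∀ i, PowerSeries.constantCoeff (T i) = 0)
    (hTv : ∀ i, T i * (1 - T i) * v i = PowerSeries.X)
    {s : Fin r → HahnSeries ℚ ℂ} (hsT : ∀ i, s i = puiseuxHom r hr (T i * (1 - T i)))
    (hs : Function.Injective s) (hs0 : ∀ i, s i ≠ 0)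
    (hroot : ∀ i, puiseuxX * evalInt (s i)⁻¹ (earPoly r) = 1) :
    toPuiseuxHom (verticalGF r) = -(1 / 2) * ∑ i, s i ^ r * Lagrange.nodalWeight Finset.univ s i *
      (1 - 2 * puiseuxHom r hr (T i)) := by
  set κ : Fin r → HahnSeries ℚ ℂ := fun i => s i ^ r * Lagrange.nodalWeight Finset.univ s i with hκ
  -- The factors `κ i` may have poles; one power of `x`, independent of `N`, clears all of them.
  choose d hd using fun i => exists_pow_mul_mem_integralSeries (κ i)
  have hD : ∀ i, puiseuxX ^ (∑ i, d i) * κ i ∈ integralSeries := by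
    intro i
    rw [← Finset.sum_erase_add _ _ (Finset.mem_univ i), pow_add, mul_assoc]
    refine Subring.mul_mem _ (Subring.pow_mem _ ?_ _) (hd i)
    rw [← toPuiseuxHom_X]
    exact toPuiseuxHom_mem_integralSeries _
  have hxD : puiseuxX ^ (∑ i, d i) ∈ integralSeries := by
    rw [← toPuiseuxHom_X, ← map_pow]
    exact toPuiseuxHom_mem_integralSeries _
  rw [← sub_eq_zero]
  refine (mul_eq_zero.1 (eq_zero_of_forall_pow_dvd fun N => ?_)).resolve_left
    (pow_ne_zero (∑ i, d i) puiseuxX_ne_zero)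
  obtain ⟨h, hGF⟩ := exists_verticalGF_approx hr2 N
  choose e he using fun i => exists_catalan_approx (hT i) (hv i) (hTv i) (r * N)
  have ht : ∀ i, 1 - 2 * puiseuxHom r hr (T i) =
      -2 * ∑ n ∈ Finset.range (r * N + 1), (gonWeight (n + 1) : HahnSeries ℚ ℂ) * s i ^ n -
        2 * puiseuxX ^ N * puiseuxHom r hr (e i) := by
    intro i
    have := congrArg (puiseuxHom r hr) (he i)
    rw [map_add, map_evalInt, ← hsT, map_mul, map_pow, pow_mul, puiseuxHom_X_pow] at this
    rw [← one_sub_two_mul_catalanPoly, this]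
    ring
  have hS : ∑ i, κ i * (1 - 2 * puiseuxHom r hr (T i)) =
      -2 * ∑ n ∈ Finset.range (r * N + 1), (gonWeight (n + 1) : HahnSeries ℚ ℂ) *
        toPuiseuxHom (geomCoeff r (n + 1)) -
      2 * puiseuxX ^ N * ∑ i, κ i * puiseuxHom r hr (e i) := by
    have hgeom : ∀ n, toPuiseuxHom (geomCoeff r (n + 1)) = ∑ i, κ i * s i ^ n := by
      intro n
      rw [← sum_pow_mul_nodalWeight_eq hr toPuiseuxHom hs hs0 (by rwa [toPuiseuxHom_X])]
      refine Finset.sum_congr rfl fun i _ => ?_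
      rw [hκ, show n + 1 + r - 1 = r + n by omega, pow_add]
      ring
    simp_rw [ht, hgeom, mul_sub, Finset.sum_sub_distrib, Finset.mul_sum]
    congr 1
    · rw [Finset.sum_comm]
      exact Finset.sum_congr rfl fun n _ => Finset.sum_congr rfl fun i _ => by ring
    · exact Finset.sum_congr rfl fun i _ => by ring
  refine ⟨puiseuxX ^ (∑ i, d i) * toPuiseuxHom h -
    ∑ i, puiseuxX ^ (∑ i, d i) * κ i * puiseuxHom r hr (e i), ?_, ?_⟩
  · refine Subring.sub_mem _ (Subring.mul_mem _ hxD (toPuiseuxHom_mem_integralSeries _))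
      (Subring.sum_mem _ fun i _ => Subring.mul_mem _ (hD i) (orderTop_puiseuxHom_nonneg _))
  · rw [hS, hGF, map_add, map_sum, map_mul, map_pow, toPuiseuxHom_X]
    simp_rw [toPuiseuxHom_smul, mul_assoc, ← Finset.mul_sum]
    ring

/-- The generating function is algebraic since the roots are. -/
theorem isAlgebraic_of_toPuiseuxHom_eq {f : PowerSeries ℚ} {s t : Fin r → HahnSeries ℚ ℂ}
    (hr : 0 < r) (hst : ∀ i, t i * (1 - t i) = s i)
    (hroot : ∀ i, (rootPoly puiseuxX r).eval (s i) = 0)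
    (hf : toPuiseuxHom f = -(1 / 2) * ∑ i, s i ^ r * Lagrange.nodalWeight Finset.univ s i *
      (1 - 2 * t i)) : IsAlgebraic ℚ[X] f := by
  let ψ : ℚ[X] →+* HahnSeries ℚ ℂ := toPuiseuxHom.comp (algebraMap ℚ[X] (PowerSeries ℚ))
  let : Algebra ℚ[X] (HahnSeries ℚ ℂ) := ψ.toAlgebra
  let φ : PowerSeries ℚ →ₐ[ℚ[X]] HahnSeries ℚ ℂ :=
    { toPuiseuxHom with commutes' := fun _ => rfl }
  rw [← isAlgebraic_algHom_iff φ toPuiseuxHom_injective]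
  change IsAlgebraic ℚ[X] (toPuiseuxHom f)
  have hψX : ψ X = puiseuxX := by
    rw [← toPuiseuxHom_X, RingHom.comp_apply, PowerSeries.algebraMap_apply']
    simp
  have halg (a : ℚ) : IsAlgebraic ℚ[X] (a : HahnSeries ℚ ℂ) := by
    have : (a : HahnSeries ℚ ℂ) = algebraMap ℚ[X] _ (C a) :=
      (eq_ratCast (ψ.comp C) a).symm
    rw [this]
    exact isAlgebraic_algebraMap _
  have hs : ∀ i, IsAlgebraic ℚ[X] (s i) := by
    intro i
    have hmap : (X ^ r - C X * (sidePoly r).map (Int.castRingHom ℚ[X]) : ℚ[X][X]).map ψ =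
        rootPoly puiseuxX r := by
      rw [rootPoly, Polynomial.map_sub, Polynomial.map_pow, Polynomial.map_mul, map_X, map_C,
        hψX, map_map]
      congr 3
      exact RingHom.ext_int _ _
    refine ⟨X ^ r - C X * (sidePoly r).map (Int.castRingHom ℚ[X]), ?_, ?_⟩
    · intro h0
      have hd := degree_rootPoly_sub_lt puiseuxX hr
      rw [← hmap, h0, Polynomial.map_zero, zero_sub, degree_neg, degree_X_pow] at hd
      exact lt_irrefl _ hd
    · rw [aeval_def, ← eval_map]
      exact hmap ▸ hroot i
  have ht : ∀ i, IsAlgebraic ℚ[X] (1 - 2 * t i) := by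
    intro i
    refine IsAlgebraic.of_pow two_pos ?_
    rw [show (1 - 2 * t i) ^ 2 = ((1 : ℚ) : HahnSeries ℚ ℂ) - ((4 : ℚ) : HahnSeries ℚ ℂ) * s i by
      rw [← hst]; push_cast; ring]
    exact (halg 1).sub ((halg 4).mul (hs i))
  rw [hf, show -(1 / 2 : HahnSeries ℚ ℂ) = ((-(1 / 2) : ℚ) : HahnSeries ℚ ℂ) by push_cast; ring]
  refine (halg _).mul (Finset.sum_induction _ _ (fun _ _ => IsAlgebraic.add) isAlgebraic_zero
    fun i _ => (((hs i).pow r).mul ?_).mul (ht i))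
  -- The nodal weight is the product of the inverses of the differences `s i - s j`.
  exact Finset.prod_induction _ _ (fun _ _ => IsAlgebraic.mul) isAlgebraic_one
    fun j _ => ((hs i).sub (hs j)).inv

end

end

theorem theorem3p1 (r : ℕ) (hr : 2 ≤ r) :
    (∃ t : Fin r → HahnSeries ℚ ℂ,
      Function.Injective t ∧ Set.range t = smallRoots r ∧
      (∀ i, (derivative (vertPoly puiseuxX r)).eval (t i) ≠ 0) ∧
      toPuiseux (verticalGF r) =
        -(1 / 2) * ∑ i, (t i) ^ r * (1 - t i) ^ r * (1 - 2 * t i) ^ 2 /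
          (derivative (vertPoly puiseuxX r)).eval (t i)) ∧
    IsAlgebraic ℚ[X] (verticalGF r) := by
  have hr0 : 0 < r := by omega
  obtain ⟨v, T, hv, hT, hTv, hs, hroot⟩ := exists_smallRoots hr0
  set s : Fin r → HahnSeries ℚ ℂ := fun i => puiseuxHom r hr0 (T i * (1 - T i)) with hsdef
  have hs0 : ∀ i, s i ≠ 0 := by
    intro i h0
    rw [hsdef] at h0
    have h0 := (map_eq_zero_iff _ puiseuxHom_injective).1 h0
    have := hTv i
    rw [h0, zero_mul] at this
    exact PowerSeries.X_ne_zero this.symm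
  have hP : ∀ i, (rootPoly puiseuxX r).eval (s i) = 0 := by
    intro i
    rw [eval_rootPoly, ← pow_mul_evalInt_earPoly_inv r (hs0 i), mul_left_comm, hroot i, mul_one,
      sub_self]
  have hst : ∀ i, puiseuxHom r hr0 (T i) * (1 - puiseuxHom r hr0 (T i)) = s i := by
    intro i
    simp [hsdef]
  have hnodal := rootPoly_eq_nodal hr0 hs hP
  have hweight : ∀ i, Lagrange.nodalWeight Finset.univ s i =
      ((derivative (rootPoly puiseuxX r)).eval (s i))⁻¹ := by
    intro i
    rw [hnodal, Lagrange.nodalWeight_eq_eval_derivative_nodal (Finset.mem_univ i)]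
  have hw0 : ∀ i, (derivative (rootPoly puiseuxX r)).eval (s i) ≠ 0 := by
    intro i
    have := Lagrange.nodalWeight_ne_zero hs.injOn (Finset.mem_univ i)
    rw [hweight] at this
    exact fun h => this (by rw [h, inv_zero])
  have h2 : ∀ i, 1 - 2 * puiseuxHom r hr0 (T i) ≠ 0 := by
    intro i h
    have h' : puiseuxHom r hr0 (1 - 2 * T i) = 0 := by
      rwa [map_sub, map_mul, map_one, map_ofNat]
    have := congrArg PowerSeries.constantCoeff ((map_eq_zero_iff _ puiseuxHom_injective).1 h')
    simp [hT] at this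
  have hpos : ∀ i, 0 < (puiseuxHom r hr0 (T i)).orderTop := fun i => orderTop_puiseuxHom_pos (hT i)
  have hGF := toPuiseux_verticalGF_eq (s := s) hr hv hT hTv (fun _ => rfl) hs hs0 hroot
  refine ⟨⟨fun i => puiseuxHom r hr0 (T i), ?_, ?_, ?_, ?_⟩, ?_⟩
  · intro i j hij
    apply hs
    rw [← hst, ← hst]
    simp only at hij
    rw [hij]
  · ext t
    constructor
    · rintro ⟨i, rfl⟩
      exact ⟨isPuiseux_puiseuxHom _, by rw [eval_vertPoly, hst, hP], hpos i⟩
    · rintro ⟨-, ht, ht0⟩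
      rw [eval_vertPoly, hnodal, Lagrange.eval_nodal, Finset.prod_eq_zero_iff] at ht
      obtain ⟨i, -, hi⟩ := ht
      refine ⟨i, ?_⟩
      rw [← hst] at hi
      -- Equal values of `t(1-t)` leave `t = t_i` or `t + t_i = 1`. The latter is impossible for two
      -- series of positive order, as 1 has order 0.
      have : (t - puiseuxHom r hr0 (T i)) * (1 - (t + puiseuxHom r hr0 (T i))) = 0 := by
        linear_combination hi
      rcases mul_eq_zero.1 this with h | h
      · exact (sub_eq_zero.1 h).symm
      · have hle := HahnSeries.min_orderTop_le_orderTop_add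
          (x := t) (y := puiseuxHom r hr0 (T i))
        rw [← sub_eq_zero.1 h, HahnSeries.orderTop_one] at hle
        exact absurd (lt_min ht0 (hpos i)) (not_lt.2 hle)
  · intro i
    rw [eval_derivative_vertPoly, hst]
    exact mul_ne_zero (hw0 i) (h2 i)
  · rw [← toPuiseuxHom_apply, hGF]
    congr 1
    refine Finset.sum_congr rfl fun i _ => ?_
    -- One of the two factors `1 - 2t` in the numerator cancels against the chain rule factor in the
    -- derivative of `P_r`.
    rw [eval_derivative_vertPoly, hst, ← mul_pow, hst, hweight]
    have := h2 i
    have := hw0 i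
    field_simp
  · exact isAlgebraic_of_toPuiseuxHom_eq hr0 hst hP hGF
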